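/- Let $I,J\subset\mathbb R$ be open intervals with $0\in J$, and for $(t,a)\in I\times J$ let $F_{t,a}:\mathbb R\to\mathbb R$ be such that $(a,t,x)\mapsto F_{t,a}(x)$ is real-analytic on $J\times I\times\mathbb R$, $F_{t,a}(x+1)=F_{t,a}(x)+1$, and $F_{t,0}(x)=x+\theta(t)$ for all $t\in I$ (such a family is called admissible). Let $r>0$, let $D_r=\{z\in\mathbb C:|z|<r\}$, and let $f_t:D_r\to\mathbb C$, $t\in I$, be holomorphic maps which guide the family. This means that, with $J_r=J\cap(-r,r)$, $A_{a,r}=\{z\in\mathbb C: a^2/r<|z|<r\}$ and $\Pi_a(x)=a e^{2\pi i x}$, there are maps $f_{t,a}:A_{a,r}\to\mathbb C\setminus\{0\}$, $(t,a)\in I\times J_r$, real-analytic jointly in $(t,a,z)$ and holomorphic in $z$, such that $f_{t,a}\circ\Pi_a=\Pi_a\circ F_{t,a}$ on $\mathbb R$ for all $t\in I$ and $a\in J_r\setminus\{0\}$, and $f_{t,0}=f_t$ on $D_r\setminus\{0\}$ for all $t\in I$. For a rational number $p/q$, let the tongue $\mathcal T_{p/q}$ be the set of $(t,a)\in I\times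 J$ for which $F_{t,a}$ is an increasing homeomorphism of $\mathbb R$ with translation number $\lim_{n\to\infty}(F_{t,a}^{\circ n}(x)-x)/n=p/q$. Assume that $t_0\in I$, $\theta(t_0)=p/q$ with $p\in\mathbb Z$, $q\ge 1$, $\gcd(p,q)=1$, that $\theta'(t_0)=1$, and that $f_{t_0}^{\circ q}(z)=z+Cz^{q+1}+O(z^{q+2})$ as $z\to0$, where $C\in\mathbb C$, $C\neq0$. Then there exist an open interval $\hat I\subset I$ containing $t_0$, an open interval $\hat J\subset J$ containing $0$, and two real-analytic maps $\gamma^\pm:\hat J\to\hat I$ such that $F_{t,a}$ is an increasing homeomorphism of $\mathbb R$ for all $(t,a)\in\hat I\times\hat J$, and 1. for all $(t,a)\in\hat I\times\hat J$, we have $(t,a)\in\mathcal T_{p/q}$ if and only if $t$ lies in the closed interval with endpoints $\gamma^-(a)$ and $\gamma^+(a)$ (in whichever order these are); 2. $\displaystyle \gamma^+(a)-\gamma^-(a)\sim\frac{2|C|}{\pi q}\,a^q$ as $a\to0$. -/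

import Mathlib

open Filter Topology Asymptotics

/-- `F` is an increasing homeomorphism of the real line commuting with the translation by `1`
(a continuous strictly increasing map with `F (x + 1) = F x + 1` is automatically onto), that is,
the lift of an orientation preserving circle homeomorphism. -/
structure IsCircleLift (F : ℝ → ℝ) : Prop where
  continuous : Continuous F
  strictMono : StrictMono F
  map_add_one : ∀ x, F (x + 1) = F x + 1

/-- The translation number `lim (F^n (x) - x) / n` of the lift of a circle homeomorphism. -/
noncomputable def transNumber (F : ℝ → ℝ) (hF : IsCircleLift F) : ℝ :=
  CircleDeg1Lift.translationNumber
    ({ toFun := F, monotone' := hF.strictMono.monotone, map_add_one' := hF.map_add_one } :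
      CircleDeg1Lift)

/-- The tongue of translation number `τ` of the family `(F t a)`, `(t, a) ∈ I × J`: the parameters
`(t, a)` for which `F t a` is the lift of a circle homeomorphism, with translation number `τ`. -/
def tongue (I J : Set ℝ) (F : ℝ → ℝ → ℝ → ℝ) (τ : ℝ) : Set (ℝ × ℝ) :=
  {w | w.1 ∈ I ∧ w.2 ∈ J ∧ ∃ h : IsCircleLift (F w.1 w.2), transNumber (F w.1 w.2) h = τ}

/-- The family `(F t a)`, `(t, a) ∈ I × J`, is admissible, and `F t 0` is the translation
by `θ t`. -/
structure IsAdmissible (I J : Set ℝ) (F : ℝ → ℝ → ℝ → ℝ) (θ : ℝ → ℝ) : Prop where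
  analytic : AnalyticOnNhd ℝ (fun v : ℝ × ℝ × ℝ => F v.2.1 v.1 v.2.2)
    (J ×ˢ (I ×ˢ (Set.univ : Set ℝ)))
  map_add_one : ∀ t ∈ I, ∀ a ∈ J, ∀ x, F t a (x + 1) = F t a x + 1
  translation : ∀ t ∈ I, ∀ x, F t 0 x = x + θ t

/-- The annulus `a² / r < |z| < r`, which is invariant under the reflection in the circle
`|z| = |a|`; for `a = 0` it is the punctured disk of radius `r`. -/
def annulus (a r : ℝ) : Set ℂ := {z | a ^ 2 / r < ‖z‖ ∧ ‖z‖ < r}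

/-- The map `x ↦ a * exp (2 π i x)` from the real line to the circle `|z| = |a|`. -/
noncomputable def circlePi (a : ℝ) (x : ℝ) : ℂ :=
  (a : ℂ) * Complex.exp (2 * (Real.pi : ℂ) * Complex.I * (x : ℂ))

/-- The family `(F t a)`, `(t, a) ∈ I × J`, is guided by the family of holomorphic maps
`f t : D_r → ℂ`, `t ∈ I`. The maps `g t a` are the maps from the annulus to the punctured plane,
jointly real-analytic in `(t, a, z)` and holomorphic in `z`. The semiconjugacy is required for
`a ≠ 0`, since for `a = 0` the circle `|z| = |a|` degenerates to a point outside the annulus. -/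
def IsGuidedBy (I J : Set ℝ) (F : ℝ → ℝ → ℝ → ℝ) (r : ℝ) (f : ℝ → ℂ → ℂ) : Prop :=
  (∀ t ∈ I, DifferentiableOn ℂ (f t) (Metric.ball 0 r)) ∧
  ∃ g : ℝ → ℝ → ℂ → ℂ,
    AnalyticOnNhd ℝ (fun v : ℝ × ℝ × ℂ => g v.1 v.2.1 v.2.2)
      {v | v.1 ∈ I ∧ v.2.1 ∈ J ∩ Set.Ioo (-r) r ∧ v.2.2 ∈ annulus v.2.1 r} ∧
    (∀ t ∈ I, ∀ a ∈ J ∩ Set.Ioo (-r) r, DifferentiableOn ℂ (g t a) (annulus a r)) ∧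
    (∀ t ∈ I, ∀ a ∈ J ∩ Set.Ioo (-r) r, ∀ z ∈ annulus a r, g t a z ≠ 0) ∧
    (∀ t ∈ I, ∀ a ∈ J ∩ Set.Ioo (-r) r, a ≠ 0 → ∀ x : ℝ,
      g t a (circlePi a x) = circlePi a (F t a x)) ∧
    (∀ t ∈ I, ∀ z ∈ Metric.ball (0 : ℂ) r, z ≠ 0 → g t 0 z = f t z)

/-! Near `(t₀, 0)` the map `F t a` is a circle lift, and it has translation number `p / q` exactly
when `(F t a)^[q] x = x + p` for some `x`. The `t`-derivative of the left side at `a = 0` is `q`, so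
this equation is solved by an analytic function `t = τ (a, x)`, `1`-periodic in `x`
(`exists_isLocalTongue`). For fixed `a` the tongue is the range of `τ (a, ·)`, an interval, and
everything reduces to the oscillation of `τ (a, ·)`.

Write `τ (a, x) - τ (a, 0) = a ^ k * H_k (a, x)`, where `H_k` is `tongueQuotient τ k`, as long as
`H_j (0, ·) = 0` for `j < k`. Two facts restrict the Fourier coefficients of `H_k (0, ·)`. First, `τ
(a, ·)` is constant along periodic orbits, so `H_k (0, ·)` is invariant under the rotation by `p /
q` and only multiples of `q` occur. Second, along `t = τ (a, 0)` the displacement of the `q`-th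
iterate is `-q a ^ k H_k + o(a ^ k)`; read on the circle `|z| = a`, its Fourier coefficient of index
`n` is about `a ^ n` times a Laurent coefficient of the guiding map, and these Laurent coefficients
converge (`exists_tendsto_laurent`). Hence indices `n > k` do not occur, and for `n = k = q` the
limit is `C` (`fourier_tongueQuotient`).

Consequently `H_k (0, ·) = 0` for `0 ≤ k < q`, and `H_q (0, x) = c + A cos (2πq(x - x₀))` with `A =
|C| / (πq)`, of oscillation `2|C| / (πq)`. The `q` maxima per period persist for small `a`; they are
joined by orbits, on which `H_q (a, ·)` is constant, so the maximum is attained at one analytic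
critical point `ξ a` (`exists_analytic_max`). The same holds for the minimum, and `γ^±` are the
values of `τ` at these points. -/

/-! ### Division of a real-analytic function by its first variable. -/

/-- The projection of the plane onto the axis `{0} × ℝ`. -/
noncomputable def sndAxisProj : ℝ × ℝ →L[ℝ] ℝ × ℝ :=
  (ContinuousLinearMap.inr ℝ ℝ ℝ).comp (ContinuousLinearMap.snd ℝ ℝ ℝ)

theorem sndAxisProj_apply (v : ℝ × ℝ) : sndAxisProj v = (0, v.2) := rfl

theorem norm_sndAxisProj_le : ‖sndAxisProj‖ ≤ 1 :=
  ContinuousLinearMap.opNorm_le_bound _ zero_le_one fun v => by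
    rw [sndAxisProj_apply, Prod.norm_def, one_mul]
    simpa using norm_snd_le v

/-- The power series of the quotient of `f v - f (0, v.2)` by `v.1`, where `p` is the power series
of `f`. -/
noncomputable def fstQuotientSeries (p : FormalMultilinearSeries ℝ (ℝ × ℝ) ℝ) :
    FormalMultilinearSeries ℝ (ℝ × ℝ) ℝ := fun n =>
  ∑ i : Fin (n + 1), ((p (n + 1)).curryMid i ((1, 0) : ℝ × ℝ)).compContinuousLinearMap
    (fun j : Fin n => if i.succAbove j < i then ContinuousLinearMap.id ℝ (ℝ × ℝ) else sndAxisProj)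

/-- Telescoping: the arguments `v` are replaced by `sndAxisProj v` one at a time. Each difference
has `v - sndAxisProj v = v.1 • (1, 0)` in one slot, and multilinearity pulls out `v.1`. -/
theorem fst_mul_fstQuotientSeries (p : FormalMultilinearSeries ℝ (ℝ × ℝ) ℝ) (n : ℕ) (v : ℝ × ℝ) :
    v.1 * fstQuotientSeries p n (fun _ => v) =
      p (n + 1) (fun _ => v) - p (n + 1) (fun _ => sndAxisProj v) := by
  have h := (p (n + 1)).toMultilinearMap.map_sub_map_piecewise (fun _ => v)
    (fun _ => sndAxisProj v) Finset.univ
  simp only [Finset.piecewise_univ, Finset.mem_univ, true_imp_iff,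
    ContinuousMultilinearMap.coe_coe] at h
  rw [h, fstQuotientSeries, _root_.sum_apply, Finset.mul_sum]
  refine Finset.sum_congr rfl fun i _ => ?_
  rw [ContinuousMultilinearMap.compContinuousLinearMap_apply,
    ContinuousMultilinearMap.curryMid_apply]
  have e : v - sndAxisProj v = v.1 • ((1, 0) : ℝ × ℝ) := by
    ext <;> simp [sndAxisProj_apply]
  set m : Fin (n + 1) → ℝ × ℝ := fun j => if j < i then v else sndAxisProj v with hm
  have h1 : (i.insertNth ((1, 0) : ℝ × ℝ) fun j : Fin n => (if i.succAbove j < i then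
      ContinuousLinearMap.id ℝ (ℝ × ℝ) else sndAxisProj) v : Fin (n + 1) → ℝ × ℝ) =
      Function.update m i (1, 0) := by
    ext1 j
    refine Fin.succAboveCases i ?_ (fun j => ?_) j
    · simp
    · rw [Fin.insertNth_apply_succAbove, Function.update_of_ne (Fin.succAbove_ne i j), hm]
      dsimp only
      split_ifs <;> rfl
  have h2 : (fun j => if j < i then v else if i = j then v - sndAxisProj v else sndAxisProj v) =
      Function.update m i (v.1 • ((1, 0) : ℝ × ℝ)) := by
    ext1 j
    rcases eq_or_ne j i with rfl | hj
    · simp [e]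
    · rw [Function.update_of_ne hj, hm]
      simp [hj.symm]
  rw [h1, h2, ContinuousMultilinearMap.map_update_smul, smul_eq_mul]

theorem norm_fstQuotientSeries_le (p : FormalMultilinearSeries ℝ (ℝ × ℝ) ℝ) (n : ℕ) :
    ‖fstQuotientSeries p n‖ ≤ (n + 1) * ‖p (n + 1)‖ := by
  have : ∀ i ∈ (Finset.univ : Finset (Fin (n + 1))),
      ‖((p (n + 1)).curryMid i ((1, 0) : ℝ × ℝ)).compContinuousLinearMap
    (fun j : Fin n => if i.succAbove j < i then ContinuousLinearMap.id ℝ (ℝ × ℝ)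
      else sndAxisProj)‖ ≤ ‖p (n + 1)‖ := by
    intro i _
    refine (ContinuousMultilinearMap.norm_compContinuousLinearMap_le _ _).trans ?_
    have h1 : ‖(p (n + 1)).curryMid i ((1, 0) : ℝ × ℝ)‖ ≤ ‖p (n + 1)‖ := by
      refine (ContinuousLinearMap.le_opNorm _ _).trans ?_
      rw [ContinuousMultilinearMap.norm_curryMid]
      simp [Prod.norm_def]
    refine (mul_le_of_le_one_right (norm_nonneg _) ?_).trans h1
    refine Finset.prod_le_one (fun _ _ => norm_nonneg _) fun j _ => ?_
    split_ifs
    · exact ContinuousLinearMap.norm_id_le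
    · exact norm_sndAxisProj_le
  refine (norm_sum_le_of_le _ this).trans ?_
  simp

theorem fstQuotientSeries_radius_pos (p : FormalMultilinearSeries ℝ (ℝ × ℝ) ℝ)
    (hp : 0 < p.radius) : 0 < (fstQuotientSeries p).radius := by
  obtain ⟨r, hr0, hr⟩ := ENNReal.lt_iff_exists_nnreal_btwn.1 hp
  obtain ⟨K, hK, h⟩ := p.norm_mul_pow_le_of_lt_radius hr
  have hr0' : (0 : ℝ) < r := by exact_mod_cast hr0
  -- Halving the radius absorbs the factor `n + 1` that counts the telescoping terms.
  have : ((r / 2 : NNReal) : ENNReal) ≤ (fstQuotientSeries p).radius := by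
    refine FormalMultilinearSeries.le_radius_of_bound _ (2 * K / r) fun n => ?_
    have h1 := norm_fstQuotientSeries_le p n
    have h2 := h (n + 1)
    have h3 : ((n : ℝ) + 1) ≤ 2 ^ (n + 1) := by exact_mod_cast (n + 1).lt_two_pow_self.le
    rw [NNReal.coe_div, NNReal.coe_ofNat, div_pow, le_div_iff₀ hr0']
    calc ‖fstQuotientSeries p n‖ * ((r : ℝ) ^ n / 2 ^ n) * r
        ≤ ((n + 1) * ‖p (n + 1)‖) * ((r : ℝ) ^ n / 2 ^ n) * r := by gcongr
      _ = (n + 1) / 2 ^ n * (‖p (n + 1)‖ * (r : ℝ) ^ (n + 1)) := by ring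
      _ ≤ 2 * K := by
        gcongr
        rw [div_le_iff₀ (by positivity), ← pow_succ']
        exact h3
  refine lt_of_lt_of_le ?_ this
  exact_mod_cast half_pos hr0'

theorem AnalyticAt.exists_sub_eq_fst_mul {f : ℝ × ℝ → ℝ} {x₀ : ℝ} (hf : AnalyticAt ℝ f (0, x₀)) :
    ∃ w : ℝ × ℝ → ℝ, AnalyticAt ℝ w (0, x₀) ∧
      ∀ᶠ v in 𝓝 ((0 : ℝ), x₀), f v - f (0, v.2) = v.1 * w v := by
  obtain ⟨p, R, hp⟩ := hf
  have hq := (fstQuotientSeries p).hasFPowerSeriesOnBall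
    (fstQuotientSeries_radius_pos p (hp.r_pos.trans_le hp.r_le))
  set S := (fstQuotientSeries p).sum
  refine ⟨fun v => S (v - (0, x₀)), ?_, ?_⟩
  · refine AnalyticAt.fun_comp (g := S) ?_ (by fun_prop)
    simpa using hq.analyticAt
  · have hc : ContinuousAt (fun v : ℝ × ℝ => v - (0, x₀)) (0, x₀) := by fun_prop
    have hmem : ∀ ρ : ENNReal, 0 < ρ → ∀ᶠ v in 𝓝 ((0 : ℝ), x₀), v - (0, x₀) ∈ Metric.eball 0 ρ := by
      intro ρ hρ
      refine hc.eventually_mem ?_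
      rw [sub_self]
      exact Metric.eball_mem_nhds _ hρ
    filter_upwards [hmem R hp.r_pos, hmem _ hq.r_pos] with v h1 h2
    set y := v - (0, x₀) with hy
    have h1' : sndAxisProj y ∈ Metric.eball (0 : ℝ × ℝ) R := by
      rw [mem_eball_zero_iff] at h1 ⊢
      refine lt_of_le_of_lt ?_ h1
      rw [enorm_le_iff_norm_le, sndAxisProj_apply]
      simp [Prod.norm_def]
    have s1 := (hp.hasSum h1).sub (hp.hasSum h1')
    have s2 := (hq.hasSum h2).mul_left y.1
    have e1 : ((0, x₀) + y : ℝ × ℝ) = v := by rw [hy]; abel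
    have e2 : ((0, x₀) + sndAxisProj y : ℝ × ℝ) = (0, v.2) := by
      rw [sndAxisProj_apply, hy]; ext <;> simp
    have e3 : y.1 = v.1 := by simp [hy]
    simp only [fst_mul_fstQuotientSeries] at s2
    rw [hasSum_nat_add_iff' 1 |>.symm] at s1
    have h0 : p 0 (fun _ => y) = p 0 (fun _ => sndAxisProj y) := by
      congr 1; funext i; exact i.elim0
    rw [Finset.sum_range_one, h0, sub_self, sub_zero, e1, e2] at s1
    rw [s1.unique s2, zero_add, e3]

/-- Off the axis `dslope` is the quotient, and on it the partial derivative, so it agrees with the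
analytic quotient near the base point. Having a global formula, it can be iterated and inherits
periodicity in the second variable. -/
theorem AnalyticAt.dslope_fst {f : ℝ × ℝ → ℝ} {x₀ : ℝ} (hf : AnalyticAt ℝ f (0, x₀)) :
    AnalyticAt ℝ (fun v : ℝ × ℝ => dslope (fun b => f (b, v.2)) 0 v.1) (0, x₀) := by
  obtain ⟨w, hw, h⟩ := hf.exists_sub_eq_fst_mul
  refine hw.congr ?_
  filter_upwards [h.eventually_nhds, hw.eventually_analyticAt.eventually_nhds] with v hv hwv
  rcases eq_or_ne v.1 0 with h0 | h0
  · have hv0 : v = (0, v.2) := by ext <;> simp [h0]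
    have hcw : ContinuousAt (fun b : ℝ => w (b, v.2)) 0 := by
      have h1 : ContinuousAt w (0, v.2) := hv0 ▸ hwv.self_of_nhds.continuousAt
      exact ContinuousAt.comp (g := w) (f := fun b : ℝ => (b, v.2)) h1 (by fun_prop)
    have hev : ∀ᶠ b in 𝓝 (0 : ℝ), f (b, v.2) - f (0, v.2) = b * w (b, v.2) := by
      have : Tendsto (fun b : ℝ => (b, v.2)) (𝓝 0) (𝓝 (0, v.2)) :=
        Continuous.tendsto (by fun_prop) 0
      rw [hv0] at hv
      exact this.eventually hv
    have hd : HasDerivAt (fun b => f (b, v.2)) (w (0, v.2)) 0 := by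
      rw [hasDerivAt_iff_tendsto_slope]
      refine (hcw.tendsto.mono_left nhdsWithin_le_nhds).congr' ?_
      filter_upwards [hev.filter_mono nhdsWithin_le_nhds, self_mem_nhdsWithin] with b hb hb0
      rw [slope_def_field, hb, sub_zero, mul_div_cancel_left₀ _ hb0]
    rw [h0, dslope_same, hd.deriv, ← hv0]
  · rw [dslope_of_ne _ h0, slope_def_field, Prod.mk.eta, hv.self_of_nhds, sub_zero]
    field_simp

/-! ### Uniformity over a period, and functions with few Fourier coefficients. -/

theorem eventually_forall_of_periodic {X : Type*} [TopologicalSpace X] {y₀ : X} {P : X → ℝ → Prop}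
    (hper : ∀ᶠ y in 𝓝 y₀, ∀ x, P y (x + 1) ↔ P y x)
    (h : ∀ x, ∀ᶠ z in 𝓝 (y₀, x), P z.1 z.2) : ∀ᶠ y in 𝓝 y₀, ∀ x, P y x := by
  have h1 := (isCompact_Icc (a := (0 : ℝ)) (b := 1)).eventually_forall_of_forall_eventually
    (P := P) (x₀ := y₀) (fun y _ => h y)
  filter_upwards [hper, h1] with y hy hy1 x
  have hp : Function.Periodic (P y) 1 := fun x => propext (hy x)
  obtain ⟨x', hx', e⟩ := hp.exists_mem_Ico₀ one_pos x
  rw [e]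
  exact hy1 x' ⟨hx'.1, hx'.2.le⟩

/-- Since `h` is real, the coefficients of index `n` and `-n` are conjugate. Only `0` and `±q`
survive, so the Fourier series is finite and sums to `h` pointwise. -/
theorem eq_add_re_of_fourier_eq_zero {h : ℝ → ℝ} (hc : Continuous h) (hper : ∀ x, h (x + 1) = h x)
    {q : ℕ} (hq : 0 < q)
    (hz : ∀ n : ℕ, 0 < n → n ≠ q →
      ∫ x in (0 : ℝ)..1, (h x : ℂ) * Complex.exp (-(2 * Real.pi * Complex.I * n * x)) = 0) :
    ∃ c : ℝ, ∀ x : ℝ, h x = c + 2 * ((∫ x in (0 : ℝ)..1, (h x : ℂ) *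
      Complex.exp (-(2 * Real.pi * Complex.I * q * x))) *
        Complex.exp (2 * Real.pi * Complex.I * q * x)).re := by
  have hP : Function.Periodic (fun x => (h x : ℂ)) 1 := fun x => by simp [hper]
  have hcl : Continuous hP.lift := by
    refine continuous_coinduced_dom.2 ?_
    exact Complex.continuous_ofReal.comp hc
  have : Fact ((0 : ℝ) < 1) := ⟨one_pos⟩
  set f : C(AddCircle (1 : ℝ), ℂ) := ⟨hP.lift, hcl⟩ with hf
  have hfx : ∀ x : ℝ, f (x : AddCircle (1 : ℝ)) = h x := fun x => hP.lift_coe x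
  set e : ℤ → ℝ → ℂ := fun n x => Complex.exp (2 * Real.pi * Complex.I * n * x) with he
  have hfou : ∀ (n : ℤ) (x : ℝ), fourier n (x : AddCircle (1 : ℝ)) = e n x := by
    intro n x
    rw [fourier_coe_apply]
    simp [he]
  have hco : ∀ n : ℤ, fourierCoeff f n = ∫ x in (0 : ℝ)..1, (h x : ℂ) * e (-n) x := by
    intro n
    rw [fourierCoeff_eq_intervalIntegral f n 0]
    simp only [hfou, hfx, smul_eq_mul, zero_add]
    norm_num
    exact intervalIntegral.integral_congr fun x _ => mul_comm _ _
  have hconj : ∀ n : ℤ, fourierCoeff f (-n) = (starRingEnd ℂ) (fourierCoeff f n) := by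
    intro n
    rw [hco, hco, ← intervalIntegral.intervalIntegral_conj]
    refine intervalIntegral.integral_congr fun x _ => ?_
    simp only [he, map_mul, Complex.conj_ofReal, ← Complex.exp_conj, Complex.conj_I, map_ofNat,
      map_intCast, Int.cast_neg, map_neg]
    ring_nf
  have hnat : ∀ n : ℕ, fourierCoeff f n =
      ∫ x in (0 : ℝ)..1, (h x : ℂ) * Complex.exp (-(2 * Real.pi * Complex.I * n * x)) := by
    intro n
    rw [hco]
    refine intervalIntegral.integral_congr fun x _ => ?_
    simp only [he, Int.cast_neg, Int.cast_natCast]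
    ring_nf
  have hzero : ∀ n : ℤ, n ∉ ({0, (q : ℤ), -(q : ℤ)} : Finset ℤ) → fourierCoeff f n = 0 := by
    intro n hn
    simp only [Finset.mem_insert, Finset.mem_singleton, not_or] at hn
    obtain ⟨m, rfl | rfl⟩ := n.eq_nat_or_neg
    · rw [hnat]; exact hz m (by omega) (by omega)
    · rw [hconj, hnat, hz m (by omega) (by omega), map_zero]
  have hsum : Summable (fourierCoeff f) := summable_of_ne_finset_zero hzero
  refine ⟨(fourierCoeff f 0).re, fun x => ?_⟩
  have h1 := has_pointwise_sum_fourier_series_of_summable hsum (x : AddCircle (1 : ℝ))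
  have h2 := h1.unique (hasSum_sum_of_ne_finset_zero (fun n hn => by
    rw [hzero n hn, zero_smul]))
  rw [Finset.sum_insert (by simp; omega), Finset.sum_pair (by omega), hfx, hconj] at h2
  simp only [hfou, smul_eq_mul] at h2
  have h3 : e (-(q : ℤ)) x = (starRingEnd ℂ) (e q x) := by
    simp only [he, ← Complex.exp_conj, map_mul, Complex.conj_ofReal, Complex.conj_I, map_ofNat,
      map_intCast, Int.cast_neg]
    ring_nf
  have h4 : e 0 x = 1 := by simp [he]
  rw [h3, h4, ← map_mul, Complex.add_conj, mul_one] at h2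
  have h5 := congrArg Complex.re h2
  rw [← hnat]
  simpa [he] using h5

/-! ### Solving an equation for `t`, analytically and uniformly in a periodic variable. -/

theorem AnalyticAt.exists_implicit {E : Type*} [NormedAddCommGroup E] [NormedSpace ℝ E]
    [CompleteSpace E] {u : E × ℝ → ℝ} {e₀ : E} {s₀ d : ℝ} (hu : AnalyticAt ℝ u (e₀, s₀))
    (h0 : u (e₀, s₀) = 0) (hd : HasDerivAt (fun s => u (e₀, s)) d s₀) (hd0 : d ≠ 0) :
    ∃ φ : E → ℝ, AnalyticAt ℝ φ e₀ ∧ φ e₀ = s₀ ∧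
      ∀ᶠ v in 𝓝 (e₀, s₀), u v = 0 ↔ v.2 = φ v.1 := by
  have hcd : ContDiffAt ℝ ⊤ u (e₀, s₀) := hu.contDiffAt
  have hinv : (fderiv ℝ u (e₀, s₀) ∘L .inr ℝ E ℝ).IsInvertible := by
    have h1 : HasFDerivAt (fun s => u (e₀, s)) (fderiv ℝ u (e₀, s₀) ∘L .inr ℝ E ℝ) s₀ :=
      hu.differentiableAt.hasFDerivAt.comp s₀ (hasFDerivAt_prodMk_right e₀ s₀)
    have h2 := h1.unique hd.hasFDerivAt
    refine ⟨ContinuousLinearEquiv.unitsEquivAut ℝ (Units.mk0 d hd0), ?_⟩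
    rw [h2]
    ext
    simp
  refine ⟨hcd.implicitFunction (by simp) hinv, ?_, hcd.implicitFunction_apply_self _ _, ?_⟩
  · exact (hcd.contDiffAt_implicitFunction (by simp) hinv).analyticAt
  · filter_upwards [hcd.eventually_apply_eq_iff_implicitFunction (by simp) hinv] with v hv
    rw [h0] at hv
    rw [hv, eq_comm]

/-- This is strict differentiability: both values of `t` may move. It gives uniqueness of the root
`t` and, later, the displacement away from a root. -/
theorem AnalyticAt.eventually_abs_sub_sub_le {G : ℝ × ℝ × ℝ → ℝ} {t₀ d x₀ : ℝ}
    (hG : AnalyticAt ℝ G (0, t₀, x₀)) (hd : HasDerivAt (fun t => G (0, t, x₀)) d t₀)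
    {ε : ℝ} (hε : 0 < ε) :
    ∀ᶠ z in 𝓝 (((0 : ℝ), t₀, t₀), x₀),
      |G (z.1.1, z.1.2.1, z.2) - G (z.1.1, z.1.2.2, z.2) - d * (z.1.2.1 - z.1.2.2)| ≤
        ε * |z.1.2.1 - z.1.2.2| := by
  have h1 := hG.hasStrictFDerivAt.isLittleO.def hε
  have h2 : Tendsto (fun z : (ℝ × ℝ × ℝ) × ℝ =>
      (((z.1.1, z.1.2.1, z.2), (z.1.1, z.1.2.2, z.2)) : (ℝ × ℝ × ℝ) × (ℝ × ℝ × ℝ)))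
      (𝓝 ((0, t₀, t₀), x₀)) (𝓝 ((0, t₀, x₀), (0, t₀, x₀))) :=
    Continuous.tendsto (by fun_prop) _
  have h3 : fderiv ℝ G (0, t₀, x₀) (0, 1, 0) = d := by
    have hl : HasDerivAt (fun t : ℝ => ((0, t, x₀) : ℝ × ℝ × ℝ)) (0, 1, 0) t₀ :=
      (hasDerivAt_const _ _).prodMk ((hasDerivAt_id _).prodMk (hasDerivAt_const _ _))
    exact (hG.differentiableAt.hasFDerivAt.comp_hasDerivAt t₀ hl).unique hd
  filter_upwards [h2.eventually h1] with z hz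
  have e : ((z.1.1, z.1.2.1, z.2) : ℝ × ℝ × ℝ) - (z.1.1, z.1.2.2, z.2) =
      (z.1.2.1 - z.1.2.2) • ((0, 1, 0) : ℝ × ℝ × ℝ) := by
    ext <;> simp
  rw [e, map_smul, h3] at hz
  simpa [Real.norm_eq_abs, norm_smul, Prod.norm_def, mul_comm] using hz

theorem eventually_forall_abs_sub_sub_le {G : ℝ × ℝ × ℝ → ℝ} {t₀ d : ℝ}
    (hG : ∀ x, AnalyticAt ℝ G (0, t₀, x))
    (hper : ∀ᶠ y in 𝓝 ((0 : ℝ), t₀), ∀ x, G (y.1, y.2, x + 1) = G (y.1, y.2, x))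
    (hd : ∀ x, HasDerivAt (fun t => G (0, t, x)) d t₀) {ε : ℝ} (hε : 0 < ε) :
    ∀ᶠ y in 𝓝 ((0 : ℝ), t₀, t₀), ∀ x,
      |G (y.1, y.2.1, x) - G (y.1, y.2.2, x) - d * (y.2.1 - y.2.2)| ≤ ε * |y.2.1 - y.2.2| := by
  refine eventually_forall_of_periodic ?_ fun x => (hG x).eventually_abs_sub_sub_le (hd x) hε
  have h1 : Tendsto (fun y : ℝ × ℝ × ℝ => (y.1, y.2.1)) (𝓝 (0, t₀, t₀)) (𝓝 (0, t₀)) :=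
    Continuous.tendsto (by fun_prop) _
  have h2 : Tendsto (fun y : ℝ × ℝ × ℝ => (y.1, y.2.2)) (𝓝 (0, t₀, t₀)) (𝓝 (0, t₀)) :=
    Continuous.tendsto (by fun_prop) _
  filter_upwards [h1.eventually hper, h2.eventually hper] with y hy1 hy2 x
  rw [hy1 x, hy2 x]

/-- The implicit function theorem gives a branch near each `x`. With error `d / 2` the increment
estimate forces uniqueness of `t` on a window independent of `x`, so the branches agree and glue. -/
theorem exists_periodic_implicit {G : ℝ × ℝ × ℝ → ℝ} {t₀ d : ℝ}
    (hG : ∀ x, AnalyticAt ℝ G (0, t₀, x))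
    (hper : ∀ᶠ y in 𝓝 ((0 : ℝ), t₀), ∀ x, G (y.1, y.2, x + 1) = G (y.1, y.2, x))
    (h0 : ∀ x, G (0, t₀, x) = 0)
    (hd : ∀ x, HasDerivAt (fun t => G (0, t, x)) d t₀) (hd0 : 0 < d) :
    ∃ τ : ℝ × ℝ → ℝ, (∀ x, AnalyticAt ℝ τ (0, x)) ∧ (∀ x, τ (0, x) = t₀) ∧
      (∀ a x, τ (a, x + 1) = τ (a, x)) ∧
      ∀ᶠ y in 𝓝 ((0 : ℝ), t₀), ∀ x, G (y.1, y.2, x) = 0 ↔ y.2 = τ (y.1, x) := by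
  have hs := eventually_forall_abs_sub_sub_le hG hper hd (half_pos hd0)
  obtain ⟨δ, hδ, hδs⟩ := Metric.eventually_nhds_iff.1 hs
  obtain ⟨δ', hδ', hδp⟩ := Metric.eventually_nhds_iff.1 hper
  set η := min δ δ' with hη
  have hη0 : 0 < η := lt_min hδ hδ'
  set P : ℝ → ℝ → ℝ → Prop := fun a x t => |a| < η ∧ |t - t₀| < η ∧ G (a, t, x) = 0 with hP
  have huniq : ∀ a x t t', P a x t → P a x t' → t = t' := by
    rintro a x t t' ⟨ha, ht, e⟩ ⟨-, ht', e'⟩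
    have h1 := hδs (y := (a, t, t')) (by
      simp only [Prod.dist_eq, Real.dist_eq, sub_zero, max_lt_iff]
      exact ⟨ha.trans_le (min_le_left _ _), ht.trans_le (min_le_left _ _),
        ht'.trans_le (min_le_left _ _)⟩) x
    simp only [e, e', sub_self, zero_sub, abs_neg, abs_mul, abs_of_pos hd0] at h1
    have h2 : |t - t'| ≤ 0 := by nlinarith [abs_nonneg (t - t')]
    exact sub_eq_zero.1 (abs_eq_zero.1 (le_antisymm h2 (abs_nonneg _)))
  have hPper : ∀ a x, P a (x + 1) = P a x := by
    intro a x
    ext t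
    refine and_congr_right fun ha => and_congr_right fun ht => ?_
    rw [hδp (y := (a, t)) (by
      simp only [Prod.dist_eq, Real.dist_eq, sub_zero, max_lt_iff]
      exact ⟨ha.trans_le (min_le_right _ _), ht.trans_le (min_le_right _ _)⟩) x]
  -- The choice depends on `(a, x)` only through the predicate `P a x`, so periodicity of `P` makes
  -- `τ` periodic for every `a`, even where no root exists.
  set τ : ℝ × ℝ → ℝ := fun v => Classical.epsilon (P v.1 v.2) with hτ
  have hτeq : ∀ a x t, P a x t → τ (a, x) = t := fun a x t h =>
    huniq a x _ _ (Classical.epsilon_spec (p := P a x) ⟨t, h⟩) h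
  have hloc : ∀ x, ∃ φ : ℝ × ℝ → ℝ, AnalyticAt ℝ φ (0, x) ∧
      ∀ᶠ v in 𝓝 ((0 : ℝ), x), P v.1 v.2 (φ v) := by
    intro x
    have hu : AnalyticAt ℝ (fun w : (ℝ × ℝ) × ℝ => G (w.1.1, w.2, w.1.2)) ((0, x), t₀) :=
      AnalyticAt.fun_comp (g := G) (hG x)
        (AnalyticAt.prod (analyticAt_fst.fun_comp (f := Prod.fst) analyticAt_fst)
          (AnalyticAt.prod analyticAt_snd (analyticAt_snd.fun_comp (f := Prod.fst) analyticAt_fst)))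
    obtain ⟨φ, hφ, hφ0, hiff⟩ := hu.exists_implicit (h0 x) (hd x) hd0.ne'
    refine ⟨φ, hφ, ?_⟩
    have hc : Tendsto (fun v => (v, φ v)) (𝓝 ((0 : ℝ), x)) (𝓝 ((0, x), t₀)) := by
      have := (continuousAt_id.prodMk hφ.continuousAt).tendsto
      rwa [hφ0] at this
    have hlt : ∀ᶠ v in 𝓝 ((0 : ℝ), x), |φ v - t₀| < η := by
      have := hφ.continuousAt.tendsto.eventually (Metric.ball_mem_nhds (φ (0, x)) hη0)
      rw [hφ0] at this
      exact this
    have ha : ∀ᶠ v in 𝓝 ((0 : ℝ), x), |v.1| < η := by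
      have h1 : ContinuousAt (fun v : ℝ × ℝ => |v.1|) (0, x) := by fun_prop
      exact h1.eventually_lt continuousAt_const (by simpa using hη0)
    filter_upwards [hc.eventually hiff, hlt, ha] with v h1 h2 h3
    exact ⟨h3, h2, h1.2 rfl⟩
  have hex : ∀ᶠ a in 𝓝 (0 : ℝ), ∀ x, ∃ t, P a x t := by
    refine eventually_forall_of_periodic (Eventually.of_forall fun a x => by rw [hPper]) fun x => ?_
    obtain ⟨φ, -, h⟩ := hloc x
    filter_upwards [h] with v hv using ⟨_, hv⟩
  have hτ0 : ∀ x, τ (0, x) = t₀ := fun x => hτeq _ _ _ ⟨by simpa, by simpa, h0 x⟩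
  refine ⟨τ, fun x => ?_, hτ0, fun a x => ?_, ?_⟩
  · obtain ⟨φ, hφ, h⟩ := hloc x
    refine hφ.congr ?_
    filter_upwards [h] with v hv using (hτeq _ _ _ hv).symm
  · simp only [hτ, hPper]
  · have hη1 : ∀ᶠ y in 𝓝 ((0 : ℝ), t₀), |y.1| < η ∧ |y.2 - t₀| < η := by
      filter_upwards [Metric.ball_mem_nhds ((0 : ℝ), t₀) hη0] with y hy
      simpa [Prod.dist_eq, Real.dist_eq] using hy
    have hex' : ∀ᶠ y in 𝓝 ((0 : ℝ), t₀), ∀ x, ∃ t, P y.1 x t :=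
      (continuous_fst.tendsto ((0 : ℝ), t₀)).eventually hex
    filter_upwards [hη1, hex'] with y hy hye x
    constructor
    · exact fun h => (hτeq _ _ _ ⟨hy.1, hy.2, h⟩).symm
    · obtain ⟨t, ht⟩ := hye x
      intro h
      rw [h, hτeq _ _ _ ht]
      exact ht.2.2

/-! ### Circles, annuli and circle averages. -/

theorem isOpen_annulus (a r : ℝ) : IsOpen (annulus a r) :=
  (isOpen_lt continuous_const continuous_norm).inter (isOpen_lt continuous_norm continuous_const)

theorem mem_annulus_of_le {a r : ℝ} (ha : 0 < a) (har : a < r) {z : ℂ} (h1 : a ≤ ‖z‖)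
    (h2 : ‖z‖ < r) : z ∈ annulus a r := by
  refine ⟨lt_of_lt_of_le ?_ h1, h2⟩
  rw [div_lt_iff₀ (ha.trans har)]
  nlinarith

theorem norm_circlePi {a : ℝ} (ha : 0 < a) (x : ℝ) : ‖circlePi a x‖ = a := by
  have : Complex.exp (2 * (Real.pi : ℂ) * Complex.I * (x : ℂ)) =
      Complex.exp (((2 * Real.pi * x : ℝ) : ℂ) * Complex.I) := by
    congr 1; push_cast; ring
  rw [circlePi, this, norm_mul, Complex.norm_exp_ofReal_mul_I, mul_one, Complex.norm_real,
    Real.norm_of_nonneg ha.le]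

theorem continuous_circlePi (a : ℝ) : Continuous (circlePi a) := by
  unfold circlePi; fun_prop

theorem exists_circlePi_eq {a : ℝ} {z : ℂ} (hz : ‖z‖ = a) :
    ∃ x, circlePi a x = z := by
  refine ⟨z.arg / (2 * Real.pi), ?_⟩
  have : (Real.pi : ℂ) ≠ 0 := by exact_mod_cast Real.pi_ne_zero
  rw [circlePi, ← hz]
  nth_rewrite 3 [← Complex.norm_mul_exp_arg_mul_I z]
  congr 2
  push_cast
  field_simp

theorem circleIntegral_inv_smul_eq {R : ℝ} (hR : R ≠ 0) (f : ℂ → ℂ) :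
    (∮ z in C(0, R), (z - 0)⁻¹ • f z) =
      2 * Real.pi * Complex.I * ∫ x in (0 : ℝ)..1, f (circlePi R x) := by
  have h1 : ∀ θ : ℝ, deriv (circleMap 0 R) θ • ((circleMap 0 R θ - 0)⁻¹ • f (circleMap 0 R θ)) =
      Complex.I * f (circleMap 0 R θ) := by
    intro θ
    have := circleMap_ne_center (c := 0) (θ := θ) hR
    rw [deriv_circleMap, sub_zero, smul_smul, smul_eq_mul]
    field_simp
  have h2 : ∀ x : ℝ, circlePi R x = circleMap 0 R (2 * Real.pi * x) := by
    intro x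
    rw [circlePi, circleMap, zero_add]
    congr 2
    push_cast
    ring
  have h3 := intervalIntegral.smul_integral_comp_mul_left (a := 0) (b := 1)
    (fun θ => f (circleMap 0 R θ)) (2 * Real.pi)
  simp only [circleIntegral, h1, h2]
  rw [mul_zero, mul_one] at h3
  rw [intervalIntegral.integral_const_mul, ← h3, Complex.real_smul]
  push_cast
  ring

/-- The maximum principle on an annulus. -/
theorem norm_le_of_norm_le_on_annulus {f : ℂ → ℂ} {a ρ B : ℝ}
    (hd : ∀ z : ℂ, a ≤ ‖z‖ → ‖z‖ ≤ ρ → DifferentiableAt ℂ f z)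
    (h1 : ∀ z : ℂ, ‖z‖ = a → ‖f z‖ ≤ B) (h2 : ∀ z : ℂ, ‖z‖ = ρ → ‖f z‖ ≤ B) {z : ℂ}
    (hz1 : a ≤ ‖z‖) (hz2 : ‖z‖ ≤ ρ) : ‖f z‖ ≤ B := by
  rcases hz1.eq_or_lt with h | hz1
  · exact h1 z h.symm
  rcases hz2.eq_or_lt with h | hz2
  · exact h2 z h
  set U : Set ℂ := {z | a < ‖z‖ ∧ ‖z‖ < ρ} with hU
  have hUo : IsOpen U :=
    (isOpen_lt continuous_const continuous_norm).inter (isOpen_lt continuous_norm continuous_const)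
  have hcl : closure U ⊆ {z | a ≤ ‖z‖ ∧ ‖z‖ ≤ ρ} :=
    closure_minimal (fun z hz => ⟨hz.1.le, hz.2.le⟩)
      ((isClosed_le continuous_const continuous_norm).inter
        (isClosed_le continuous_norm continuous_const))
  refine Complex.norm_le_of_forall_mem_frontier_norm_le (U := U) ?_ ?_ ?_ (subset_closure ⟨hz1, hz2⟩)
  · exact Metric.isBounded_ball.subset (t := Metric.ball 0 ρ) fun z hz => by simpa using hz.2
  · refine DifferentiableOn.diffContOnCl fun z hz => ?_
    exact (hd z (hcl hz).1 (hcl hz).2).differentiableWithinAt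
  · intro w hw
    rw [hUo.frontier_eq] at hw
    have hw' := hcl hw.1
    rcases hw'.1.eq_or_lt with h | h
    · exact h1 w h.symm
    rcases hw'.2.eq_or_lt with h' | h'
    · exact h2 w h'
    · exact absurd ⟨h, h'⟩ hw.2

theorem circleAverage_eq_of_differentiableAt {f : ℂ → ℂ} {a ρ : ℝ} (ha : 0 < a) (haρ : a ≤ ρ)
    (hd : ∀ z : ℂ, a ≤ ‖z‖ → ‖z‖ ≤ ρ → DifferentiableAt ℂ f z) :
    ∫ x in (0 : ℝ)..1, f (circlePi ρ x) = ∫ x in (0 : ℝ)..1, f (circlePi a x) := by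
  have h := Complex.circleIntegral_sub_center_inv_smul_eq_of_differentiable_on_annulus_off_countable
    (c := 0) ha haρ (f := f) Set.countable_empty
    (fun z hz => (hd z (by simpa using hz.2) (by simpa using hz.1)).continuousAt.continuousWithinAt)
    (fun z hz => hd z (by simpa using (le_of_lt (by simpa using hz.1.2)))
      (by simpa using (le_of_lt (by simpa using hz.1.1))))
  rw [circleIntegral_inv_smul_eq (ha.trans_le haρ).ne', circleIntegral_inv_smul_eq ha.ne'] at h
  exact mul_left_cancel₀ Complex.two_pi_I_ne_zero h

/-! ### Bounds for guiding maps and convergence of their Laurent coefficients. -/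

/-- Holomorphic maps `g a`, defined on annuli around the circles `|z| = a` which they preserve, and
converging to a holomorphic map `φ` as `a` tends to `0`. -/
structure IsGuide (r : ℝ) (g : ℝ → ℂ → ℂ) (φ : ℂ → ℂ) : Prop where
  pos : 0 < r
  differentiableOn_limit : DifferentiableOn ℂ φ (Metric.ball 0 r)
  continuousAt : ∀ z : ℂ, z ≠ 0 → ‖z‖ < r → ContinuousAt (fun w : ℝ × ℂ => g w.1 w.2) (0, z)
  limit_eq : ∀ z : ℂ, z ≠ 0 → ‖z‖ < r → g 0 z = φ z
  differentiableOn : ∀ᶠ a in 𝓝 0, DifferentiableOn ℂ (g a) (annulus a r)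
  ne_zero : ∀ᶠ a in 𝓝 0, ∀ z ∈ annulus a r, g a z ≠ 0
  norm_eq : ∀ᶠ a in 𝓝[>] 0, ∀ z : ℂ, ‖z‖ = a → ‖g a z‖ = a

namespace IsGuide

variable {r : ℝ} {g : ℝ → ℂ → ℂ} {φ : ℂ → ℂ}

theorem limit_ne_zero (h : IsGuide r g φ) {z : ℂ} (hz : z ≠ 0) (hzr : ‖z‖ < r) : φ z ≠ 0 := by
  rw [← h.limit_eq z hz hzr]
  refine h.ne_zero.self_of_nhds z ⟨?_, hzr⟩
  simpa using hz

/-- The maximum principle is applied to `1 / g a` and to `g a z / z`. The inner circle is preserved,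
and on the outer circle `g a` is compared with `φ`, which has no zero there. The lower bound keeps
orbits out of the disk `|z| < a`, so iteration stays legitimate. -/
theorem exists_bounds (h : IsGuide r g φ) : ∃ M ρ : ℝ, 1 ≤ M ∧ 0 < ρ ∧ ρ < r ∧
    ∀ᶠ a in 𝓝[>] 0, ∀ z : ℂ, a ≤ ‖z‖ → ‖z‖ ≤ ρ →
      a ≤ ‖g a z‖ ∧ ‖g a z‖ ≤ M * ‖z‖ ∧ DifferentiableAt ℂ (g a) z := by
  have hr := h.pos
  set ρ := r / 2 with hρ
  have hρ0 : 0 < ρ := half_pos hr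
  have hρr : ρ < r := half_lt_self hr
  have hK : IsCompact (Metric.sphere (0 : ℂ) ρ) := isCompact_sphere 0 ρ
  have hKz : ∀ z ∈ Metric.sphere (0 : ℂ) ρ, ‖z‖ = ρ := fun z hz => by simpa using hz
  have hK0 : ∀ z ∈ Metric.sphere (0 : ℂ) ρ, z ≠ 0 := fun z hz => by
    rw [← norm_pos_iff, hKz z hz]; exact hρ0
  have hKne : (Metric.sphere (0 : ℂ) ρ).Nonempty := NormedSpace.sphere_nonempty.2 hρ0.le
  have hφc : ContinuousOn (fun z => ‖φ z‖) (Metric.sphere 0 ρ) :=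
    (h.differentiableOn_limit.continuousOn.mono fun z hz => by
      simpa using (hKz z hz).trans_lt hρr).norm
  obtain ⟨z₁, hz₁, hmin⟩ := hK.exists_isMinOn hKne hφc
  obtain ⟨z₂, hz₂, hmax⟩ := hK.exists_isMaxOn hKne hφc
  have hm0 : 0 < ‖φ z₁‖ :=
    norm_pos_iff.2 (h.limit_ne_zero (hK0 _ hz₁) ((hKz _ hz₁).trans_lt hρr))
  -- The `1` serves the inner circle, where `|g a z / z| = 1`.
  set M := max 1 ((‖φ z₂‖ + 1) / ρ) with hM
  have hMρ : ‖φ z₂‖ < M * ρ := by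
    have : (‖φ z₂‖ + 1) / ρ ≤ M := le_max_right _ _
    rw [div_le_iff₀ hρ0] at this
    linarith
  have hcirc : ∀ᶠ a in 𝓝 (0 : ℝ), ∀ z ∈ Metric.sphere (0 : ℂ) ρ,
      ‖φ z₁‖ / 2 < ‖g a z‖ ∧ ‖g a z‖ < M * ρ := by
    refine hK.eventually_forall_of_forall_eventually (P := fun a z =>
      ‖φ z₁‖ / 2 < ‖g a z‖ ∧ ‖g a z‖ < M * ρ) fun z hz => ?_
    have hc := (h.continuousAt z (hK0 z hz) ((hKz z hz).trans_lt hρr)).norm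
    have e := h.limit_eq z (hK0 z hz) ((hKz z hz).trans_lt hρr)
    have h1 : ‖φ z₁‖ ≤ ‖φ z‖ := hmin hz
    have h2 : ‖φ z‖ ≤ ‖φ z₂‖ := hmax hz
    refine (continuousAt_const.eventually_lt hc ?_).and (hc.eventually_lt continuousAt_const ?_)
    · dsimp only; rw [e]; linarith
    · dsimp only; rw [e]; linarith
  refine ⟨M, ρ, le_max_left _ _, hρ0, hρr, ?_⟩
  have hsm : ∀ᶠ a in 𝓝 (0 : ℝ), a < ρ ∧ a < ‖φ z₁‖ / 2 :=
    (eventually_lt_nhds hρ0).and (eventually_lt_nhds (half_pos hm0))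
  filter_upwards [hcirc.filter_mono nhdsWithin_le_nhds, hsm.filter_mono nhdsWithin_le_nhds,
    h.differentiableOn.filter_mono nhdsWithin_le_nhds, h.ne_zero.filter_mono nhdsWithin_le_nhds,
    h.norm_eq, self_mem_nhdsWithin] with a hcirc hsm hd hne heq ha
  replace ha : 0 < a := ha
  have hmem : ∀ z : ℂ, a ≤ ‖z‖ → ‖z‖ ≤ ρ → z ∈ annulus a r := fun z h1 h2 =>
    mem_annulus_of_le ha (hsm.1.trans hρr) h1 (h2.trans_lt hρr)
  have hda : ∀ z : ℂ, a ≤ ‖z‖ → ‖z‖ ≤ ρ → DifferentiableAt ℂ (g a) z := fun z h1 h2 =>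
    hd.differentiableAt ((isOpen_annulus a r).mem_nhds (hmem z h1 h2))
  have hz0 : ∀ z : ℂ, a ≤ ‖z‖ → z ≠ 0 := fun z hz => norm_pos_iff.1 (ha.trans_le hz)
  have hsph : ∀ z : ℂ, ‖z‖ = ρ → z ∈ Metric.sphere (0 : ℂ) ρ := fun z hz => by simpa using hz
  intro z hz1 hz2
  refine ⟨?_, ?_, hda z hz1 hz2⟩
  · have := norm_le_of_norm_le_on_annulus (f := fun z => (g a z)⁻¹) (B := a⁻¹)
      (fun z h1 h2 => (hda z h1 h2).inv (hne z (hmem z h1 h2)))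
      (fun z hz => by rw [norm_inv, heq z hz])
      (fun z hz => by
        rw [norm_inv]
        exact inv_anti₀ ha (hsm.2.trans (hcirc z (hsph z hz)).1).le) hz1 hz2
    rw [norm_inv] at this
    exact (inv_le_inv₀ (norm_pos_iff.2 (hne z (hmem z hz1 hz2))) ha).1 this
  · have := norm_le_of_norm_le_on_annulus (f := fun z => g a z / z) (B := M)
      (fun z h1 h2 => (hda z h1 h2).div differentiableAt_id (hz0 z h1))
      (fun z hz => by
        rw [norm_div, heq z hz, hz, div_self ha.ne']
        exact le_max_left _ _)
      (fun z hz => by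
        rw [norm_div, hz, div_le_iff₀ hρ0]
        exact (hcirc z (hsph z hz)).2.le) hz1 hz2
    rwa [norm_div, div_le_iff₀ (ha.trans_le hz1)] at this

end IsGuide

theorem iterate_bounds {u : ℂ → ℂ} {a M ρ : ℝ} (hM : 1 ≤ M)
    (hu : ∀ z : ℂ, a ≤ ‖z‖ → ‖z‖ ≤ ρ → a ≤ ‖u z‖ ∧ ‖u z‖ ≤ M * ‖z‖ ∧ DifferentiableAt ℂ u z)
    {q : ℕ} {z : ℂ} (hz1 : a ≤ ‖z‖) (hz2 : M ^ q * ‖z‖ ≤ ρ) {j : ℕ} (hj : j ≤ q) :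
    a ≤ ‖u^[j] z‖ ∧ ‖u^[j] z‖ ≤ M ^ j * ‖z‖ ∧ DifferentiableAt ℂ u^[j] z := by
  induction j with
  | zero => exact ⟨hz1, by simp, differentiableAt_id⟩
  | succ j ih =>
    obtain ⟨h1, h2, h3⟩ := ih (by omega)
    have h4 : ‖u^[j] z‖ ≤ ρ := h2.trans <| le_trans
      (mul_le_mul_of_nonneg_right (pow_le_pow_right₀ hM (by omega)) (norm_nonneg z)) hz2
    obtain ⟨k1, k2, k3⟩ := hu _ h1 h4
    rw [Function.iterate_succ']
    refine ⟨k1, ?_, k3.comp z h3⟩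
    calc ‖u (u^[j] z)‖ ≤ M * ‖u^[j] z‖ := k2
      _ ≤ M * (M ^ j * ‖z‖) := by gcongr
      _ = M ^ (j + 1) * ‖z‖ := by ring

namespace IsGuide

variable {r : ℝ} {g : ℝ → ℂ → ℂ} {φ : ℂ → ℂ}

theorem tendsto (h : IsGuide r g φ) {z : ℂ} (hz : z ≠ 0) (hzr : ‖z‖ < r) {u : ℝ → ℂ}
    {l : Filter ℝ} (hl : l ≤ 𝓝 0) (hu : Tendsto u l (𝓝 z)) :
    Tendsto (fun a => g a (u a)) l (𝓝 (φ z)) := by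
  have h1 := (h.continuousAt z hz hzr).tendsto
  rw [h.limit_eq z hz hzr] at h1
  have h2 : Tendsto (fun a : ℝ => (a, u a)) l (𝓝 (0, z)) := by
    rw [nhds_prod_eq]
    exact (tendsto_id.mono_left hl).prodMk hu
  exact h1.comp h2

theorem exists_iterate_bounds (h : IsGuide r g φ) (q : ℕ) : ∃ σ B : ℝ, 0 < σ ∧
    (∀ᶠ a in 𝓝[>] 0, ∀ z : ℂ, a ≤ ‖z‖ → ‖z‖ ≤ σ →
      ‖(g a)^[q] z‖ ≤ B ∧ DifferentiableAt ℂ (g a)^[q] z) ∧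
    (∀ z : ℂ, z ≠ 0 → ‖z‖ ≤ σ → DifferentiableAt ℂ φ^[q] z ∧
      Tendsto (fun a => (g a)^[q] z) (𝓝[>] 0) (𝓝 (φ^[q] z))) := by
  obtain ⟨M, ρ, hM, hρ, hρr, hb⟩ := h.exists_bounds
  have hM0 : 0 < M := zero_lt_one.trans_le hM
  have hφb : ∀ z : ℂ, z ≠ 0 → ‖z‖ ≤ ρ → φ z ≠ 0 ∧ ‖φ z‖ ≤ M * ‖z‖ ∧
      DifferentiableAt ℂ φ z := by
    intro z hz hzρ
    have hzr := hzρ.trans_lt hρr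
    refine ⟨h.limit_ne_zero hz hzr, ?_, ?_⟩
    · refine le_of_tendsto (h.tendsto hz hzr (l := 𝓝[>] 0) nhdsWithin_le_nhds
        tendsto_const_nhds).norm ?_
      have h1 : ∀ᶠ a in 𝓝[>] (0 : ℝ), a < ‖z‖ :=
        (eventually_lt_nhds (norm_pos_iff.2 hz)).filter_mono nhdsWithin_le_nhds
      filter_upwards [hb, h1] with a ha h1
      exact (ha z h1.le hzρ).2.1
    · exact h.differentiableOn_limit.differentiableAt
        (Metric.isOpen_ball.mem_nhds (by simpa using hzr))
  -- Each iteration expands the modulus by at most `M`, so starting below `ρ / M ^ q` leaves room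
  -- for `q` of them.
  refine ⟨ρ / M ^ q, ρ, by positivity, ?_, ?_⟩
  · filter_upwards [hb] with a ha z hz1 hz2
    rw [le_div_iff₀' (by positivity)] at hz2
    obtain ⟨-, h2, h3⟩ := iterate_bounds hM ha hz1 hz2 le_rfl
    exact ⟨h2.trans hz2, h3⟩
  · intro z hz hz2
    rw [le_div_iff₀' (by positivity)] at hz2
    have key : ∀ j ≤ q, φ^[j] z ≠ 0 ∧ ‖φ^[j] z‖ ≤ M ^ j * ‖z‖ ∧ DifferentiableAt ℂ φ^[j] z ∧
        Tendsto (fun a => (g a)^[j] z) (𝓝[>] 0) (𝓝 (φ^[j] z)) := by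
      intro j
      induction j with
      | zero => exact fun _ => ⟨hz, by simp, differentiableAt_id, tendsto_const_nhds⟩
      | succ j ih =>
        intro hj
        obtain ⟨h1, h2, h3, h4⟩ := ih (by omega)
        have h5 : ‖φ^[j] z‖ ≤ ρ := h2.trans <| le_trans
          (mul_le_mul_of_nonneg_right (pow_le_pow_right₀ hM (by omega)) (norm_nonneg z)) hz2
        obtain ⟨k1, k2, k3⟩ := hφb _ h1 h5
        simp only [Function.iterate_succ']
        refine ⟨k1, ?_, k3.comp z h3, h.tendsto h1 (h5.trans_lt hρr) nhdsWithin_le_nhds h4⟩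
        calc ‖φ (φ^[j] z)‖ ≤ M * ‖φ^[j] z‖ := k2
          _ ≤ M * (M ^ j * ‖z‖) := by gcongr
          _ = M ^ (j + 1) * ‖z‖ := by ring
    exact (key q le_rfl).2.2

/-- The Laurent coefficients of `z ↦ (g a)^[q] z / z - 1`, computed on the circle `|z| = a`,
converge as `a` tends to `0`, and the limit for the index `q` is given by the expansion of the
limit map at the origin. -/
theorem exists_tendsto_laurent (h : IsGuide r g φ) {q : ℕ} {C : ℂ}
    (hexp : (fun z : ℂ => φ^[q] z - (z + C * z ^ (q + 1))) =O[𝓝 0] (fun z : ℂ => z ^ (q + 2))) :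
    ∃ c : ℕ → ℂ, c q = C ∧ ∀ n, Tendsto (fun a => ∫ x in (0 : ℝ)..1,
      ((g a)^[q] (circlePi a x) / circlePi a x - 1) / circlePi a x ^ n) (𝓝[>] 0) (𝓝 (c n)) := by
  obtain ⟨σ, B, hσ, hb, hl⟩ := h.exists_iterate_bounds q
  set ψ : ℝ → ℕ → ℂ → ℂ := fun a n z => ((g a)^[q] z / z - 1) / z ^ n with hψ
  set ψ₀ : ℕ → ℂ → ℂ := fun n z => (φ^[q] z / z - 1) / z ^ n with hψ₀
  have hσ0 : ∀ x, circlePi σ x ≠ 0 := fun x => norm_pos_iff.1 (by rwa [norm_circlePi hσ])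
  refine ⟨fun n => ∫ x in (0 : ℝ)..1, ψ₀ n (circlePi σ x), ?_, fun n => ?_⟩
  · have hd : ∀ z : ℂ, z ≠ 0 → ‖z‖ ≤ σ → DifferentiableAt ℂ (ψ₀ q) z := fun z hz hzσ =>
      (((hl z hz hzσ).1.div differentiableAt_id hz).sub_const 1).div
        (differentiableAt_id.pow q) (pow_ne_zero q hz)
    -- By the expansion, `ψ₀ q` extends over the origin with value `C`, which is therefore its mean
    -- on the circle of radius `σ`.
    have hy : Tendsto (ψ₀ q) (𝓝[≠] 0) (𝓝 C) := by
      have h1 : (fun z => ψ₀ q z - C) =O[𝓝[≠] 0] (fun z : ℂ => z) := by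
        have h2 := (hexp.mono (nhdsWithin_le_nhds (s := {0}ᶜ))).mul
          (isBigO_refl (fun z : ℂ => (z ^ (q + 1))⁻¹) (𝓝[≠] 0))
        refine (h2.congr' ?_ ?_)
        · filter_upwards [self_mem_nhdsWithin] with z hz
          have hz : z ≠ 0 := hz
          simp only [hψ₀]
          field_simp
          ring
        · filter_upwards [self_mem_nhdsWithin] with z hz
          have hz : z ≠ 0 := hz
          field_simp
          ring
      have h3 : Tendsto (fun z : ℂ => z) (𝓝[≠] 0) (𝓝 0) := nhdsWithin_le_nhds
      exact tendsto_sub_nhds_zero_iff.1 (h1.trans_tendsto h3)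
    have h4 := Complex.circleIntegral_sub_center_inv_smul_of_differentiable_on_off_countable_of_tendsto
      (c := 0) hσ (f := ψ₀ q) Set.countable_empty
      (fun z hz => (hd z (by simpa using hz.2)
        (by simpa using hz.1)).continuousAt.continuousWithinAt)
      (fun z hz => hd z (by simpa using hz.1.2) (le_of_lt (by simpa using hz.1.1))) hy
    rw [circleIntegral_inv_smul_eq hσ.ne', smul_eq_mul] at h4
    exact mul_left_cancel₀ Complex.two_pi_I_ne_zero h4
  · have hsm : ∀ᶠ a in 𝓝[>] (0 : ℝ), a < σ :=
      (eventually_lt_nhds hσ).filter_mono nhdsWithin_le_nhds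
    have hdψ : ∀ᶠ a in 𝓝[>] (0 : ℝ), ∀ z : ℂ, a ≤ ‖z‖ → ‖z‖ ≤ σ →
        DifferentiableAt ℂ (ψ a n) z := by
      filter_upwards [hb, self_mem_nhdsWithin] with a ha ha0 z hz1 hz2
      have hz : z ≠ 0 := norm_pos_iff.1 (lt_of_lt_of_le ha0 hz1)
      exact (((ha z hz1 hz2).2.div differentiableAt_id hz).sub_const 1).div
        (differentiableAt_id.pow n) (pow_ne_zero n hz)
    -- By holomorphy between the circles, the average moves from the shrinking circle `|z| = a` to
    -- the fixed circle `|z| = σ`, where dominated convergence applies.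
    have hcongr : ∀ᶠ a in 𝓝[>] (0 : ℝ), ∫ x in (0 : ℝ)..1, ψ a n (circlePi σ x) =
        ∫ x in (0 : ℝ)..1, ψ a n (circlePi a x) := by
      filter_upwards [hdψ, hsm, self_mem_nhdsWithin] with a ha ha1 ha0
      exact circleAverage_eq_of_differentiableAt ha0 ha1.le ha
    refine Tendsto.congr' hcongr ?_
    refine intervalIntegral.tendsto_integral_filter_of_dominated_convergence
      (fun _ => (B / σ + 1) / σ ^ n) ?_ ?_ intervalIntegrable_const ?_
    · filter_upwards [hdψ, hsm] with a ha ha1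
      refine Continuous.aestronglyMeasurable ?_
      refine continuous_iff_continuousAt.2 fun x => ?_
      exact ContinuousAt.comp (g := ψ a n) (ha _ (by rw [norm_circlePi hσ]; exact ha1.le)
        (norm_circlePi hσ x).le).continuousAt (continuous_circlePi σ).continuousAt
    · filter_upwards [hb, hsm] with a ha ha1
      refine Eventually.of_forall fun x _ => ?_
      have h1 := (ha (circlePi σ x) (by rw [norm_circlePi hσ]; exact ha1.le)
        (norm_circlePi hσ x).le).1
      simp only [hψ]
      rw [norm_div, norm_pow, norm_circlePi hσ]
      gcongr
      refine (norm_sub_le _ _).trans ?_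
      rw [norm_div, norm_circlePi hσ, norm_one]
      gcongr
    · refine Eventually.of_forall fun x _ => ?_
      have h1 := (hl (circlePi σ x) (hσ0 x) (norm_circlePi hσ x).le).2
      exact ((h1.div_const _).sub_const 1).div_const _

end IsGuide

/-! ### The periodic-point equation of an admissible family. -/

theorem iterate_add_one {u : ℝ → ℝ} (hu : ∀ x, u (x + 1) = u x + 1) (k : ℕ) (x : ℝ) :
    u^[k] (x + 1) = u^[k] x + 1 :=
  Function.Commute.iterate_left (g := fun x => x + 1) hu k x

theorem iterate_add_int {u : ℝ → ℝ} (hu : ∀ x, u (x + 1) = u x + 1) (k : ℕ) (x : ℝ) (m : ℤ) :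
    u^[k] (x + m) = u^[k] x + m := by
  have hp : Function.Periodic (fun x => u^[k] x - x) 1 := fun x => by
    simp only [iterate_add_one hu]; ring
  have := hp.int_mul m x
  simp only [mul_one] at this
  linarith

/-- Near the parameter `(0, t₀)`, the equation `F t a^[q] x = x + p` of the periodic points is
solved by `t = τ (a, x)`, with `τ` analytic and `1`-periodic in `x`. -/
structure IsLocalTongue (F : ℝ → ℝ → ℝ → ℝ) (t₀ : ℝ) (p : ℤ) (q : ℕ) (τ : ℝ × ℝ → ℝ) : Prop where
  continuousAt_iterate : ∀ k x,
    ContinuousAt (fun v : ℝ × ℝ × ℝ => (F v.2.1 v.1)^[k] v.2.2) (0, t₀, x)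
  iterate_zero : ∀ k x, (F t₀ 0)^[k] x = x + k * ((p : ℝ) / q)
  isCircleLift : ∀ᶠ y in 𝓝 ((0 : ℝ), t₀), IsCircleLift (F y.2 y.1)
  approx : ∀ ε > 0, ∀ᶠ y in 𝓝 ((0 : ℝ), t₀, t₀), ∀ x,
    |(F y.2.1 y.1)^[q] x - (F y.2.2 y.1)^[q] x - q * (y.2.1 - y.2.2)| ≤ ε * |y.2.1 - y.2.2|
  analyticAt : ∀ x, AnalyticAt ℝ τ (0, x)
  zero_left : ∀ x, τ (0, x) = t₀
  periodic : ∀ a x, τ (a, x + 1) = τ (a, x)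
  iterate_eq_iff : ∀ᶠ y in 𝓝 ((0 : ℝ), t₀), ∀ x, (F y.2 y.1)^[q] x = x + p ↔ y.2 = τ (y.1, x)

namespace IsAdmissible

variable {I J : Set ℝ} {F : ℝ → ℝ → ℝ → ℝ} {θ : ℝ → ℝ}

theorem analyticAt_iterate (hF : IsAdmissible I J F θ) (k : ℕ) {v : ℝ × ℝ × ℝ}
    (hv : v ∈ J ×ˢ (I ×ˢ (Set.univ : Set ℝ))) :
    AnalyticAt ℝ (fun v : ℝ × ℝ × ℝ => (F v.2.1 v.1)^[k] v.2.2) v := by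
  induction k with
  | zero => exact analyticAt_snd.fun_comp (f := Prod.snd) analyticAt_snd
  | succ k ih =>
    simp only [Function.iterate_succ', Function.comp]
    exact AnalyticAt.fun_comp (g := fun v : ℝ × ℝ × ℝ => F v.2.1 v.1 v.2.2)
      (f := fun v : ℝ × ℝ × ℝ => (v.1, v.2.1, (F v.2.1 v.1)^[k] v.2.2))
      (hF.analytic _ ⟨hv.1, hv.2.1, trivial⟩)
      (AnalyticAt.prod analyticAt_fst
        (AnalyticAt.prod (analyticAt_fst.fun_comp (f := Prod.snd) analyticAt_snd) ih))

theorem iterate_zero (hF : IsAdmissible I J F θ) {t : ℝ} (ht : t ∈ I) (k : ℕ) (x : ℝ) :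
    (F t 0)^[k] x = x + k * θ t := by
  induction k with
  | zero => simp
  | succ k ih =>
    rw [Function.iterate_succ_apply', ih, hF.translation t ht]
    push_cast
    ring

theorem eventually_mem (hI : IsOpen I) (hJ : IsOpen J) (hJ0 : (0 : ℝ) ∈ J) {t₀ : ℝ} (ht₀ : t₀ ∈ I) :
    ∀ᶠ y in 𝓝 ((0 : ℝ), t₀), y.1 ∈ J ∧ y.2 ∈ I :=
  (hJ.prod hI).mem_nhds ⟨hJ0, ht₀⟩

/-- At `a = 0` the map is a translation, of derivative `1`; by compactness of a period the
derivative stays positive for nearby parameters. -/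
theorem eventually_isCircleLift (hF : IsAdmissible I J F θ) (hI : IsOpen I) (hJ : IsOpen J)
    (hJ0 : (0 : ℝ) ∈ J) {t₀ : ℝ} (ht₀ : t₀ ∈ I) :
    ∀ᶠ y in 𝓝 ((0 : ℝ), t₀), IsCircleLift (F y.2 y.1) := by
  set S : ℝ × ℝ × ℝ → ℝ := fun v => F v.2.1 v.1 v.2.2 with hS
  have hmem := eventually_mem hI hJ hJ0 ht₀
  have hline : ∀ v : ℝ × ℝ × ℝ, v ∈ J ×ˢ (I ×ˢ (Set.univ : Set ℝ)) →
      HasDerivAt (F v.2.1 v.1) (fderiv ℝ S v (0, 0, 1)) v.2.2 := by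
    intro v hv
    have hl : HasDerivAt (fun x : ℝ => ((v.1, v.2.1, x) : ℝ × ℝ × ℝ)) (0, 0, 1) v.2.2 :=
      (hasDerivAt_const _ _).prodMk ((hasDerivAt_const _ _).prodMk (hasDerivAt_id _))
    exact (hF.analytic v hv).differentiableAt.hasFDerivAt.comp_hasDerivAt v.2.2 hl
  have hpos : ∀ᶠ y in 𝓝 ((0 : ℝ), t₀), ∀ x, deriv (F y.2 y.1) x > 0 := by
    refine eventually_forall_of_periodic ?_ fun x => ?_
    · filter_upwards [hmem] with y hy x
      have : (fun x => F y.2 y.1 (x + 1)) = fun x => F y.2 y.1 x + 1 :=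
        funext (hF.map_add_one y.2 hy.2 y.1 hy.1)
      have h1 := congrFun (congrArg deriv this) x
      rw [deriv_comp_add_const, deriv_add_const] at h1
      rw [h1]
    · have hmem0 : ((0 : ℝ), t₀, x) ∈ J ×ˢ (I ×ˢ (Set.univ : Set ℝ)) := ⟨hJ0, ht₀, trivial⟩
      have han := hF.analytic _ hmem0
      have hc : ContinuousAt (fun v => fderiv ℝ S v (0, 0, 1)) (0, t₀, x) :=
        han.fderiv.continuousAt.clm_apply continuousAt_const
      have h1 : fderiv ℝ S (0, t₀, x) (0, 0, 1) = 1 := by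
        have h2 := hline _ hmem0
        have h3 : F t₀ 0 = fun x => x + θ t₀ := funext (hF.translation t₀ ht₀)
        dsimp only at h2
        rw [h3] at h2
        exact h2.unique ((hasDerivAt_id x).add_const _)
      have h4 : ∀ᶠ v in 𝓝 ((0 : ℝ), t₀, x), 0 < fderiv ℝ S v (0, 0, 1) :=
        continuousAt_const.eventually_lt hc (by rw [h1]; exact one_pos)
      have h5 : ∀ᶠ v in 𝓝 ((0 : ℝ), t₀, x), v ∈ J ×ˢ (I ×ˢ (Set.univ : Set ℝ)) :=
        (hJ.prod (hI.prod isOpen_univ)).mem_nhds hmem0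
      have h6 : Tendsto (fun z : (ℝ × ℝ) × ℝ => ((z.1.1, z.1.2, z.2) : ℝ × ℝ × ℝ))
          (𝓝 ((0, t₀), x)) (𝓝 (0, t₀, x)) := Continuous.tendsto (by fun_prop) _
      filter_upwards [h6.eventually h4, h6.eventually h5] with z hz1 hz2
      rw [(hline _ hz2).deriv]
      exact hz1
  filter_upwards [hmem, hpos] with y hy hy1
  refine ⟨?_, strictMono_of_deriv_pos hy1, hF.map_add_one y.2 hy.2 y.1 hy.1⟩
  exact continuous_iff_continuousAt.2 fun x =>
    (hline (y.1, y.2, x) ⟨hy.1, hy.2, trivial⟩).continuousAt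

theorem exists_isLocalTongue (hF : IsAdmissible I J F θ) (hI : IsOpen I) (hJ : IsOpen J)
    (hJ0 : (0 : ℝ) ∈ J) {t₀ : ℝ} (ht₀ : t₀ ∈ I) {p : ℤ} {q : ℕ} (hq : 0 < q)
    (hθ : θ t₀ = (p : ℝ) / (q : ℝ)) (hθ' : HasDerivAt θ 1 t₀) :
    ∃ τ, IsLocalTongue F t₀ p q τ := by
  have hq0 : (0 : ℝ) < q := by exact_mod_cast hq
  have hmem := eventually_mem hI hJ hJ0 ht₀
  set G : ℝ × ℝ × ℝ → ℝ := fun v => (F v.2.1 v.1)^[q] v.2.2 - v.2.2 - p with hG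
  have hGa : ∀ x, AnalyticAt ℝ G (0, t₀, x) := fun x =>
    ((hF.analyticAt_iterate q ⟨hJ0, ht₀, trivial⟩).sub
      (analyticAt_snd.fun_comp (f := Prod.snd) analyticAt_snd)).sub analyticAt_const
  have hper : ∀ᶠ y in 𝓝 ((0 : ℝ), t₀), ∀ x, G (y.1, y.2, x + 1) = G (y.1, y.2, x) := by
    filter_upwards [hmem] with y hy x
    simp only [hG]
    rw [iterate_add_one (hF.map_add_one y.2 hy.2 y.1 hy.1)]
    ring
  have h0 : ∀ x, G (0, t₀, x) = 0 := by
    intro x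
    simp only [hG]
    rw [hF.iterate_zero ht₀, hθ]
    field_simp
    ring
  -- For `a = 0` the `q`-th iterate is the translation by `q * θ t`, and `θ' (t₀) = 1`.
  have hd : ∀ x, HasDerivAt (fun t => G (0, t, x)) q t₀ := by
    intro x
    have h1 : HasDerivAt (fun t => x + q * θ t - x - p) ((q : ℝ) * 1) t₀ :=
      (((hθ'.const_mul (q : ℝ)).const_add x).sub_const x).sub_const (p : ℝ)
    rw [mul_one] at h1
    refine h1.congr_of_eventuallyEq ?_
    filter_upwards [hI.mem_nhds ht₀] with t ht
    simp only [hG]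
    rw [hF.iterate_zero ht]
  obtain ⟨τ, h1, h2, h3, h4⟩ := exists_periodic_implicit hGa hper h0 hd hq0
  refine ⟨τ, fun k x => (hF.analyticAt_iterate k ⟨hJ0, ht₀, trivial⟩).continuousAt,
    fun k x => by rw [hF.iterate_zero ht₀, hθ],
    hF.eventually_isCircleLift hI hJ hJ0 ht₀, fun ε hε => ?_, h1, h2, h3, ?_⟩
  · filter_upwards [eventually_forall_abs_sub_sub_le hGa hper hd hε] with y hy x
    refine le_of_eq_of_le ?_ (hy x)
    simp only [hG]
    congr 1
    ring
  · filter_upwards [h4] with y hy x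
    rw [← hy x]
    simp only [hG]
    constructor <;> intro h <;> linarith

end IsAdmissible

namespace IsLocalTongue

variable {F : ℝ → ℝ → ℝ → ℝ} {t₀ : ℝ} {p : ℤ} {q : ℕ} {τ : ℝ × ℝ → ℝ}

theorem tendsto_prod (h : IsLocalTongue F t₀ p q τ) (x : ℝ) :
    Tendsto (fun v : ℝ × ℝ => (v.1, τ v)) (𝓝 (0, x)) (𝓝 (0, t₀)) := by
  have := (continuousAt_fst.prodMk (h.analyticAt x).continuousAt).tendsto
  rwa [h.zero_left] at this

theorem eventually_forall (h : IsLocalTongue F t₀ p q τ) {P : ℝ × ℝ → Prop}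
    (hP : ∀ᶠ y in 𝓝 ((0 : ℝ), t₀), P y) : ∀ᶠ a in 𝓝 (0 : ℝ), ∀ x, P (a, τ (a, x)) :=
  eventually_forall_of_periodic (Eventually.of_forall fun a x => by rw [h.periodic])
    fun x => (h.tendsto_prod x).eventually hP

theorem eventually_iterate_eq (h : IsLocalTongue F t₀ p q τ) :
    ∀ᶠ a in 𝓝 (0 : ℝ), ∀ x, (F (τ (a, x)) a)^[q] x = x + p := by
  filter_upwards [h.eventually_forall h.iterate_eq_iff] with a ha x
  exact (ha x x).2 rfl

/-- If `x` solves the equation for `t = τ (a, x)`, so does its whole orbit under `F t a`; uniqueness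
of the root gives the same `τ`. -/
theorem eventually_apply_iterate (h : IsLocalTongue F t₀ p q τ) :
    ∀ᶠ a in 𝓝 (0 : ℝ), ∀ (x : ℝ) (k : ℕ), τ (a, (F (τ (a, x)) a)^[k] x) = τ (a, x) := by
  filter_upwards [h.eventually_forall h.iterate_eq_iff, h.eventually_forall h.isCircleLift]
    with a ha h1 x k
  refine ((ha x _).1 ?_).symm
  rw [← Function.iterate_add_apply, add_comm, Function.iterate_add_apply, (ha x x).2 rfl,
    iterate_add_int (h1 x).map_add_one]

end IsLocalTongue

/-! ### Expansion of `τ` in powers of `a`, and its rotational symmetry. -/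

/-- The quotient of `h v - h (0, v.2)` by `v.1`. -/
noncomputable def fstQuotient (h : ℝ × ℝ → ℝ) : ℝ × ℝ → ℝ := fun v =>
  dslope (fun b => h (b, v.2)) 0 v.1

theorem fst_mul_fstQuotient (h : ℝ × ℝ → ℝ) (v : ℝ × ℝ) :
    v.1 * fstQuotient h v = h v - h (0, v.2) := by
  have := sub_smul_dslope (fun b => h (b, v.2)) 0 v.1
  simpa [fstQuotient] using this

/-- The iterated quotient of `τ (a, x) - τ (a, 0)` by `a ^ k`. -/
noncomputable def tongueQuotient (τ : ℝ × ℝ → ℝ) (k : ℕ) : ℝ × ℝ → ℝ :=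
  fstQuotient^[k] fun v => τ v - τ (v.1, 0)

theorem tongueQuotient_succ (τ : ℝ × ℝ → ℝ) (k : ℕ) :
    tongueQuotient τ (k + 1) = fstQuotient (tongueQuotient τ k) :=
  Function.iterate_succ_apply' _ _ _

theorem tongueQuotient_zero_right (τ : ℝ × ℝ → ℝ) (k : ℕ) (a : ℝ) :
    tongueQuotient τ k (a, 0) = 0 := by
  induction k generalizing a with
  | zero => simp [tongueQuotient]
  | succ k ih =>
    have : (fun b => tongueQuotient τ k (b, 0)) = fun _ => 0 := funext ih
    rw [tongueQuotient_succ, fstQuotient]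
    dsimp only
    rw [this]
    rcases eq_or_ne a 0 with rfl | ha
    · simp
    · simp [dslope_of_ne _ ha, slope]

theorem sub_eq_pow_mul_tongueQuotient {τ : ℝ × ℝ → ℝ} {k : ℕ}
    (h : ∀ j < k, ∀ x, tongueQuotient τ j (0, x) = 0) (v : ℝ × ℝ) :
    τ v - τ (v.1, 0) = v.1 ^ k * tongueQuotient τ k v := by
  induction k with
  | zero => simp [tongueQuotient]
  | succ k ih =>
    rw [ih fun j hj => h j (by omega), pow_succ, mul_assoc, tongueQuotient_succ,
      fst_mul_fstQuotient, h k (by omega), sub_zero]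

theorem tendsto_exp_sub_one_div {ι : Type*} {l : Filter ι} {w s : ι → ℂ} {L : ℂ}
    (hw : Tendsto (fun i => w i / s i) l (𝓝 L)) (hs : Tendsto s l (𝓝 0))
    (hs0 : ∀ᶠ i in l, s i ≠ 0) : Tendsto (fun i => (Complex.exp (w i) - 1) / s i) l (𝓝 L) := by
  have hw0 : Tendsto w l (𝓝 0) := by
    have := hw.mul hs
    rw [mul_zero] at this
    refine this.congr' ?_
    filter_upwards [hs0] with i hi using div_mul_cancel₀ _ hi
  have hd : ContinuousAt (dslope Complex.exp 0) 0 :=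
    continuousAt_dslope_same.2 Complex.differentiableAt_exp
  have h1 := hw.mul (hd.tendsto.comp hw0)
  rw [dslope_same, Complex.deriv_exp, Complex.exp_zero, mul_one] at h1
  refine h1.congr fun i => ?_
  have := sub_smul_dslope Complex.exp 0 (w i)
  rw [sub_zero, smul_eq_mul, Complex.exp_zero] at this
  rw [Function.comp, ← this]
  ring

/-- The dictionary between Laurent coefficients on `|z| = a` and Fourier coefficients in `x`; the
integer `p` disappears under the exponential. -/
theorem circlePi_div_sub_one_div_pow {a : ℝ} (ha : a ≠ 0) (x w : ℝ) (p : ℤ) (n : ℕ) :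
    (circlePi a (x + w + p) / circlePi a x - 1) / circlePi a x ^ n =
      ((a : ℂ) ^ n)⁻¹ * ((Complex.exp (2 * Real.pi * Complex.I * w) - 1) *
        Complex.exp (-(2 * Real.pi * Complex.I * n * x))) := by
  have ha' : (a : ℂ) ≠ 0 := by exact_mod_cast ha
  have h1 : circlePi a (x + w + p) = circlePi a x * Complex.exp (2 * Real.pi * Complex.I * w) := by
    have h2 : (2 * (Real.pi : ℂ) * Complex.I * ((x + w + p : ℝ) : ℂ)) =
        2 * Real.pi * Complex.I * x + 2 * Real.pi * Complex.I * w +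
          p * (2 * Real.pi * Complex.I) := by
      push_cast; ring
    rw [circlePi, circlePi, h2, Complex.exp_add, Complex.exp_add, Complex.exp_int_mul_two_pi_mul_I]
    ring
  have h0 : circlePi a x ≠ 0 := mul_ne_zero ha' (Complex.exp_ne_zero _)
  have h3 : circlePi a x ^ n = (a : ℂ) ^ n * Complex.exp (2 * Real.pi * Complex.I * n * x) := by
    rw [circlePi, mul_pow, ← Complex.exp_nat_mul]
    congr 2
    ring
  rw [h1, mul_div_cancel_left₀ _ h0, h3, Complex.exp_neg]
  field_simp

namespace IsLocalTongue

variable {F : ℝ → ℝ → ℝ → ℝ} {t₀ : ℝ} {p : ℤ} {q : ℕ} {τ : ℝ × ℝ → ℝ}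

theorem analyticAt_tongueQuotient (h : IsLocalTongue F t₀ p q τ) (k : ℕ) (x : ℝ) :
    AnalyticAt ℝ (tongueQuotient τ k) (0, x) := by
  induction k generalizing x with
  | zero =>
    refine (h.analyticAt x).sub ?_
    exact AnalyticAt.fun_comp (f := fun v : ℝ × ℝ => (v.1, (0 : ℝ))) (h.analyticAt 0)
      (AnalyticAt.prod analyticAt_fst analyticAt_const)
  | succ k ih =>
    rw [tongueQuotient_succ]
    exact (ih x).dslope_fst

theorem tongueQuotient_periodic (h : IsLocalTongue F t₀ p q τ) (k : ℕ) (a x : ℝ) :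
    tongueQuotient τ k (a, x + 1) = tongueQuotient τ k (a, x) := by
  induction k generalizing a with
  | zero => simp [tongueQuotient, h.periodic]
  | succ k ih => simp only [tongueQuotient_succ, fstQuotient, ih]

theorem continuous_tongueQuotient (h : IsLocalTongue F t₀ p q τ) (k : ℕ) :
    Continuous fun x => tongueQuotient τ k (0, x) :=
  continuous_iff_continuousAt.2 fun x =>
    ContinuousAt.comp (f := fun x : ℝ => ((0 : ℝ), x))
      (h.analyticAt_tongueQuotient k x).continuousAt (by fun_prop)

theorem exists_tongueQuotient_bound (h : IsLocalTongue F t₀ p q τ) (k : ℕ) :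
    ∃ B, ∀ᶠ a in 𝓝 (0 : ℝ), ∀ x, |tongueQuotient τ k (a, x)| ≤ B := by
  obtain ⟨B, hB⟩ := (isCompact_Icc (a := (0 : ℝ)) (b := 1)).exists_bound_of_continuousOn
    (h.continuous_tongueQuotient k).continuousOn
  have hB' : ∀ x, |tongueQuotient τ k (0, x)| ≤ B := by
    intro x
    have hp : Function.Periodic (fun x => tongueQuotient τ k (0, x)) 1 :=
      h.tongueQuotient_periodic k 0
    obtain ⟨y, hy, e⟩ := hp.exists_mem_Ico₀ one_pos x
    rw [show tongueQuotient τ k (0, x) = tongueQuotient τ k (0, y) from e]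
    exact hB y ⟨hy.1, hy.2.le⟩
  refine ⟨B + 1, eventually_forall_of_periodic
    (Eventually.of_forall fun a x => by rw [h.tongueQuotient_periodic]) fun x => ?_⟩
  have hc := (h.analyticAt_tongueQuotient k x).continuousAt.abs
  filter_upwards [hc.eventually_lt continuousAt_const ((hB' x).trans_lt (lt_add_one B))] with v hv
  exact hv.le

theorem eventually_tongueQuotient_apply_iterate (h : IsLocalTongue F t₀ p q τ) {k : ℕ}
    (hk : ∀ j < k, ∀ x, tongueQuotient τ j (0, x) = 0) :
    ∀ᶠ a in 𝓝[≠] (0 : ℝ), ∀ (x : ℝ) (m : ℕ),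
      tongueQuotient τ k (a, (F (τ (a, x)) a)^[m] x) = tongueQuotient τ k (a, x) := by
  filter_upwards [h.eventually_apply_iterate.filter_mono nhdsWithin_le_nhds, self_mem_nhdsWithin]
    with a ha ha0 x m
  have h1 := sub_eq_pow_mul_tongueQuotient hk (a, (F (τ (a, x)) a)^[m] x)
  rw [ha x m, sub_eq_pow_mul_tongueQuotient hk (a, x)] at h1
  exact (mul_left_cancel₀ (pow_ne_zero k ha0) h1).symm

/-- Invariance along one step of the orbit, in the limit `a → 0`, where `F t₀ 0` is the translation
by `p / q`. The limit avoids `a = 0` because invariance of the quotient comes from cancelling `a ^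
k`. -/
theorem tongueQuotient_add_div (h : IsLocalTongue F t₀ p q τ) {k : ℕ}
    (hk : ∀ j < k, ∀ x, tongueQuotient τ j (0, x) = 0) (x : ℝ) :
    tongueQuotient τ k (0, x + (p : ℝ) / q) = tongueQuotient τ k (0, x) := by
  have hle : 𝓝[≠] (0 : ℝ) ≤ 𝓝 0 := nhdsWithin_le_nhds
  have hax : Tendsto (fun a : ℝ => (a, x)) (𝓝[≠] 0) (𝓝 (0, x)) :=
    (Continuous.tendsto (by fun_prop) 0).mono_left hle
  have h1 : Tendsto (fun a : ℝ => (F (τ (a, x)) a)^[1] x) (𝓝[≠] 0) (𝓝 (x + (p : ℝ) / q)) := by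
    have h2 : Tendsto (fun a : ℝ => ((a, τ (a, x), x) : ℝ × ℝ × ℝ)) (𝓝[≠] 0) (𝓝 (0, t₀, x)) := by
      have h3 := (h.analyticAt x).continuousAt.tendsto.comp hax
      rw [h.zero_left] at h3
      simp only [nhds_prod_eq]
      exact (tendsto_id.mono_left hle).prodMk (h3.prodMk tendsto_const_nhds)
    have h3 := (h.continuousAt_iterate 1 x).tendsto.comp h2
    dsimp only at h3
    rw [h.iterate_zero, Nat.cast_one, one_mul] at h3
    exact h3
  have h4 : Tendsto (fun a : ℝ => (a, (F (τ (a, x)) a)^[1] x)) (𝓝[≠] 0)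
      (𝓝 (0, x + (p : ℝ) / q)) := by
    rw [nhds_prod_eq]
    exact (tendsto_id.mono_left hle).prodMk h1
  have h5 := (h.analyticAt_tongueQuotient k (x + (p : ℝ) / q)).continuousAt.tendsto.comp h4
  have h6 := (h.analyticAt_tongueQuotient k x).continuousAt.tendsto.comp hax
  refine tendsto_nhds_unique (h5.congr' ?_) h6
  filter_upwards [h.eventually_tongueQuotient_apply_iterate hk] with a ha
  exact ha x 1

/-- The Fourier coefficient of index `n` vanishes unless `q` divides `n`. -/
theorem fourier_tongueQuotient_eq_zero_of_not_dvd (h : IsLocalTongue F t₀ p q τ) (hq : 0 < q)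
    (hpq : Int.gcd p q = 1) {k : ℕ}
    (hk : ∀ j < k, ∀ x, tongueQuotient τ j (0, x) = 0) {n : ℕ} (hn : ¬ q ∣ n) :
    ∫ x in (0 : ℝ)..1, (tongueQuotient τ k (0, x) : ℂ) *
      Complex.exp (-(2 * Real.pi * Complex.I * n * x)) = 0 := by
  set f : ℝ → ℂ := fun x => (tongueQuotient τ k (0, x) : ℂ) *
      Complex.exp (-(2 * Real.pi * Complex.I * n * x)) with hf
  set s : ℝ := (p : ℝ) / q with hs
  set ω : ℂ := Complex.exp (-(2 * Real.pi * Complex.I * n * s)) with hω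
  have hfp : Function.Periodic f 1 := by
    intro x
    simp only [hf, h.tongueQuotient_periodic]
    congr 1
    rw [show -(2 * (Real.pi : ℂ) * Complex.I * n * ((x + 1 : ℝ) : ℂ)) =
      -(2 * Real.pi * Complex.I * n * x) + ((-n : ℤ) : ℂ) * (2 * Real.pi * Complex.I) by
        push_cast; ring, Complex.exp_add, Complex.exp_int_mul_two_pi_mul_I, mul_one]
  have h1 : ∫ x in (0 : ℝ)..1, f (x + s) = ∫ x in (0 : ℝ)..1, f x := by
    rw [intervalIntegral.integral_comp_add_right]
    have := hfp.intervalIntegral_add_eq s 0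
    rwa [zero_add, add_comm s 1, ← zero_add s, ← add_assoc, add_zero] at this
  -- The symmetry multiplies the coefficient by `ω`. If `ω = 1` then `q ∣ n * p`, hence `q ∣ n` by
  -- coprimality.
  have h2 : ∀ x, f (x + s) = ω * f x := by
    intro x
    simp only [hf, hs, h.tongueQuotient_add_div hk]
    rw [← hs, hω, show -(2 * (Real.pi : ℂ) * Complex.I * n * ((x + s : ℝ) : ℂ)) =
      -(2 * Real.pi * Complex.I * n * s) + -(2 * Real.pi * Complex.I * n * x) by
        push_cast; ring, Complex.exp_add]
    ring
  simp only [h2, intervalIntegral.integral_const_mul] at h1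
  have h3 : ω ≠ 1 := by
    intro h4
    rw [hω, Complex.exp_eq_one_iff] at h4
    obtain ⟨m, hm⟩ := h4
    have hq0 : (q : ℂ) ≠ 0 := by exact_mod_cast hq.ne'
    have h5 : (-(n : ℂ) * s) * (2 * Real.pi * Complex.I) = m * (2 * Real.pi * Complex.I) := by
      rw [← hm]; ring
    have h6 := mul_right_cancel₀ Complex.two_pi_I_ne_zero h5
    rw [hs] at h6
    push_cast at h6
    field_simp at h6
    have h7 : -((n : ℤ) * p) = q * m := by exact_mod_cast h6
    have h8 : (q : ℤ) ∣ n * p := ⟨-m, by linarith⟩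
    have h9 : IsCoprime (q : ℤ) p := by
      rw [Int.isCoprime_iff_gcd_eq_one, Int.gcd_comm]; exact hpq
    exact hn (by exact_mod_cast h9.dvd_of_dvd_mul_right h8)
  have h4 : (ω - 1) * ∫ x in (0 : ℝ)..1, f x = 0 := by rw [sub_mul, h1]; ring
  exact (mul_eq_zero.1 h4).resolve_left (sub_ne_zero.2 h3)

end IsLocalTongue

/-! ### Fourier coefficients of the quotients through the guiding maps. -/

namespace IsLocalTongue

variable {F : ℝ → ℝ → ℝ → ℝ} {t₀ : ℝ} {p : ℤ} {q : ℕ} {τ : ℝ × ℝ → ℝ}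

/-- Along the curve `t = τ (a, 0)`, the displacement of `F t a^[q]` is `-q a ^ k` times the
`k`-th quotient, up to `o(a ^ k)`. -/
theorem eventually_abs_displacement_add_le (h : IsLocalTongue F t₀ p q τ) {k : ℕ}
    (hk : ∀ j < k, ∀ x, tongueQuotient τ j (0, x) = 0) {ε : ℝ} (hε : 0 < ε) :
    ∀ᶠ a in 𝓝 (0 : ℝ), ∀ x,
      |((F (τ (a, 0)) a)^[q] x - x - p) + q * (a ^ k * tongueQuotient τ k (a, x))| ≤
        ε * |a ^ k * tongueQuotient τ k (a, x)| := by
  have h1 : ∀ᶠ a in 𝓝 (0 : ℝ), ∀ x, ∀ y,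
      |(F (τ (a, x)) a)^[q] y - (F (τ (a, 0)) a)^[q] y - q * (τ (a, x) - τ (a, 0))| ≤
        ε * |τ (a, x) - τ (a, 0)| := by
    refine eventually_forall_of_periodic (Eventually.of_forall fun a x => by rw [h.periodic])
      fun x => ?_
    have h2 : Tendsto (fun v : ℝ × ℝ => ((v.1, τ v, τ (v.1, 0)) : ℝ × ℝ × ℝ)) (𝓝 (0, x))
        (𝓝 (0, t₀, t₀)) := by
      have h3 : Tendsto (fun v : ℝ × ℝ => (v.1, (0 : ℝ))) (𝓝 (0, x)) (𝓝 (0, 0)) :=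
        Continuous.tendsto (by fun_prop) _
      have h4 := (h.analyticAt x).continuousAt.tendsto
      have h5 := (h.analyticAt 0).continuousAt.tendsto.comp h3
      rw [h.zero_left] at h4 h5
      rw [nhds_prod_eq (x := (0 : ℝ)) (y := (t₀, t₀)), nhds_prod_eq (x := t₀)]
      exact (continuous_fst.tendsto ((0 : ℝ), x)).prodMk (h4.prodMk h5)
    filter_upwards [h2.eventually (h.approx ε hε)] with v hv
    exact hv
  filter_upwards [h1, h.eventually_iterate_eq] with a ha hb x
  have h2 := ha x x
  rw [sub_eq_pow_mul_tongueQuotient hk (a, x), hb x] at h2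
  rw [← abs_neg]
  refine le_of_eq_of_le ?_ h2
  congr 1
  ring

theorem tendsto_displacement_div (h : IsLocalTongue F t₀ p q τ) {k : ℕ}
    (hk : ∀ j < k, ∀ x, tongueQuotient τ j (0, x) = 0) (x : ℝ) :
    Tendsto (fun a => ((F (τ (a, 0)) a)^[q] x - x - p) / a ^ k) (𝓝[>] 0)
      (𝓝 (-(q * tongueQuotient τ k (0, x)))) := by
  have hax : Tendsto (fun a : ℝ => (a, x)) (𝓝[>] 0) (𝓝 (0, x)) :=
    (Continuous.tendsto (by fun_prop) 0).mono_left nhdsWithin_le_nhds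
  have h1 := (h.analyticAt_tongueQuotient k x).continuousAt.tendsto.comp hax
  suffices h2 : Tendsto (fun a => ((F (τ (a, 0)) a)^[q] x - x - p) / a ^ k +
      q * tongueQuotient τ k (a, x)) (𝓝[>] 0) (𝓝 0) by
    have h3 := h2.sub (h1.const_mul (q : ℝ))
    rw [zero_sub] at h3
    refine h3.congr fun a => ?_
    simp
  obtain ⟨B, hB⟩ := h.exists_tongueQuotient_bound k
  have hB0 : 0 ≤ B := (abs_nonneg _).trans (hB.self_of_nhds 0)
  rw [Metric.tendsto_nhds]
  intro ε hε
  have hε' : 0 < ε / (B + 1) := by positivity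
  filter_upwards [(h.eventually_abs_displacement_add_le hk hε').filter_mono nhdsWithin_le_nhds,
    hB.filter_mono nhdsWithin_le_nhds, self_mem_nhdsWithin] with a ha hb ha0
  have ha0 : 0 < a ^ k := pow_pos ha0 k
  have h2 := ha x
  have e : ((F (τ (a, 0)) a)^[q] x - x - p) / a ^ k + q * tongueQuotient τ k (a, x) =
      (((F (τ (a, 0)) a)^[q] x - x - p) + q * (a ^ k * tongueQuotient τ k (a, x))) / a ^ k := by
    field_simp
  rw [dist_zero_right, Real.norm_eq_abs, e, abs_div, abs_of_pos ha0, div_lt_iff₀ ha0]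
  refine h2.trans_lt ?_
  rw [abs_mul, abs_of_pos ha0]
  calc ε / (B + 1) * (a ^ k * |tongueQuotient τ k (a, x)|)
      ≤ ε / (B + 1) * (a ^ k * B) := by gcongr; exact hb x
    _ < ε / (B + 1) * (a ^ k * (B + 1)) := by gcongr; linarith
    _ = ε * a ^ k := by field_simp

theorem tendsto_integral_exp_displacement (h : IsLocalTongue F t₀ p q τ) {k : ℕ} (hk0 : 0 < k)
    (hk : ∀ j < k, ∀ x, tongueQuotient τ j (0, x) = 0) (n : ℕ) :
    Tendsto (fun a : ℝ => ∫ x in (0 : ℝ)..1, (Complex.exp (2 * Real.pi * Complex.I *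
        (((F (τ (a, 0)) a)^[q] x - x - p : ℝ) : ℂ)) - 1) / (a : ℂ) ^ k *
        Complex.exp (-(2 * Real.pi * Complex.I * n * x))) (𝓝[>] 0)
      (𝓝 (-(2 * Real.pi * Complex.I * q) * ∫ x in (0 : ℝ)..1, (tongueQuotient τ k (0, x) : ℂ) *
        Complex.exp (-(2 * Real.pi * Complex.I * n * x)))) := by
  obtain ⟨B, hB⟩ := h.exists_tongueQuotient_bound k
  rw [← intervalIntegral.integral_const_mul]
  have hlift : ∀ᶠ a in 𝓝[>] (0 : ℝ), IsCircleLift (F (τ (a, 0)) a) := by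
    filter_upwards [(h.eventually_forall h.isCircleLift).filter_mono nhdsWithin_le_nhds] with a ha
    exact ha 0
  have hnorm : ∀ x : ℝ, ‖Complex.exp (-(2 * Real.pi * Complex.I * n * x))‖ = 1 := by
    intro x
    rw [show -(2 * (Real.pi : ℂ) * Complex.I * n * x) =
      ((-(2 * Real.pi * n * x) : ℝ) : ℂ) * Complex.I by push_cast; ring,
      Complex.norm_exp_ofReal_mul_I]
  refine intervalIntegral.tendsto_integral_filter_of_dominated_convergence
    -- The displacement is at most `(q + 1) * B * a ^ k`, by the estimate with error `1`, and `|exp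
    -- (i y) - 1| ≤ |y|`.
    (fun _ => 2 * Real.pi * ((q + 1) * B)) ?_ ?_ intervalIntegrable_const ?_
  · filter_upwards [hlift] with a ha
    have hc : Continuous (F (τ (a, 0)) a)^[q] := ha.continuous.iterate q
    refine Continuous.aestronglyMeasurable ?_
    fun_prop
  · filter_upwards [(h.eventually_abs_displacement_add_le hk one_pos).filter_mono
      nhdsWithin_le_nhds, hB.filter_mono nhdsWithin_le_nhds, self_mem_nhdsWithin] with a ha hb ha0
    refine Eventually.of_forall fun x _ => ?_
    have ha0 : 0 < a := ha0
    have hak : 0 < a ^ k := pow_pos ha0 k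
    set w : ℝ := (F (τ (a, 0)) a)^[q] x - x - p with hw
    have h1 : |w| ≤ (q + 1) * B * a ^ k := by
      have h2 := ha x
      have h3 : |a ^ k * tongueQuotient τ k (a, x)| ≤ B * a ^ k := by
        rw [abs_mul, abs_of_pos hak, mul_comm]
        gcongr
        exact hb x
      have h4 : |(q : ℝ) * (a ^ k * tongueQuotient τ k (a, x))| ≤ q * (B * a ^ k) := by
        rw [abs_mul, Nat.abs_cast]
        gcongr
      have h5 := abs_sub (w + q * (a ^ k * tongueQuotient τ k (a, x)))
        (q * (a ^ k * tongueQuotient τ k (a, x)))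
      rw [add_sub_cancel_right] at h5
      linarith
    have h2 : ‖Complex.exp (2 * Real.pi * Complex.I * (w : ℂ)) - 1‖ ≤ 2 * Real.pi * |w| := by
      have := Real.norm_exp_I_mul_ofReal_sub_one_le (x := 2 * Real.pi * w)
      rw [Real.norm_eq_abs, abs_mul, abs_of_pos Real.two_pi_pos] at this
      refine le_of_eq_of_le ?_ this
      congr 3
      push_cast
      ring
    rw [norm_mul, hnorm, mul_one, norm_div, norm_pow, Complex.norm_real, Real.norm_of_nonneg ha0.le,
      div_le_iff₀ hak]
    calc _ ≤ 2 * Real.pi * |w| := h2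
      _ ≤ 2 * Real.pi * ((q + 1) * B * a ^ k) := by gcongr
      _ = _ := by ring
  · refine Eventually.of_forall fun x _ => ?_
    have h1 := (Complex.continuous_ofReal.tendsto _).comp (h.tendsto_displacement_div hk x)
    have h2 := h1.const_mul (2 * Real.pi * Complex.I)
    have hs : Tendsto (fun a : ℝ => (a : ℂ) ^ k) (𝓝[>] 0) (𝓝 0) := by
      have : Tendsto (fun a : ℝ => (a : ℂ) ^ k) (𝓝 0) (𝓝 (((0 : ℝ) : ℂ) ^ k)) :=
        Continuous.tendsto (by fun_prop) 0
      rw [Complex.ofReal_zero, zero_pow hk0.ne'] at this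
      exact this.mono_left nhdsWithin_le_nhds
    have hs0 : ∀ᶠ a : ℝ in 𝓝[>] (0 : ℝ), (a : ℂ) ^ k ≠ 0 := by
      filter_upwards [self_mem_nhdsWithin] with a ha
      have ha : 0 < a := ha
      exact pow_ne_zero k (Complex.ofReal_ne_zero.2 ha.ne')
    have h3 := (tendsto_exp_sub_one_div (w := fun a : ℝ => 2 * Real.pi * Complex.I *
        (((F (τ (a, 0)) a)^[q] x - x - p : ℝ) : ℂ)) (h2.congr fun a => by
          simp only [Function.comp]
          push_cast
          ring) hs hs0).mul_const (Complex.exp (-(2 * Real.pi * Complex.I * n * x)))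
    convert h3 using 2
    push_cast
    ring

variable {r : ℝ} {g : ℝ → ℂ → ℂ} {φ : ℂ → ℂ} {C : ℂ}

/-- `a ^ n` times the `n`-th Laurent coefficient equals `a ^ k` times the `n`-th Fourier coefficient
of the rescaled displacement, whose limit is `-2πiq` times that of the quotient. The Laurent
coefficient converges, so the factor `a ^ (n - k)` kills the limit if `n > k`; if `n = k = q` the
limit is `C`. Limits from the right suffice, as they determine the values at `a = 0`. -/
theorem fourier_tongueQuotient (h : IsLocalTongue F t₀ p q τ) (hq : 0 < q) (hg : IsGuide r g φ)
    (hsemi : ∀ᶠ a in 𝓝[>] (0 : ℝ), ∀ x, g a (circlePi a x) = circlePi a (F (τ (a, 0)) a x))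
    (hexp : (fun z : ℂ => φ^[q] z - (z + C * z ^ (q + 1))) =O[𝓝 0] (fun z : ℂ => z ^ (q + 2)))
    {k : ℕ} (hk0 : 0 < k) (hk : ∀ j < k, ∀ x, tongueQuotient τ j (0, x) = 0) :
    (∀ n, k < n → ∫ x in (0 : ℝ)..1, (tongueQuotient τ k (0, x) : ℂ) *
        Complex.exp (-(2 * Real.pi * Complex.I * n * x)) = 0) ∧
    (k = q → ∫ x in (0 : ℝ)..1, (tongueQuotient τ k (0, x) : ℂ) *
        Complex.exp (-(2 * Real.pi * Complex.I * q * x)) =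
          -(C / (2 * Real.pi * Complex.I * q))) := by
  obtain ⟨c, hcq, hc⟩ := hg.exists_tendsto_laurent hexp
  have hfac : (-(2 * (Real.pi : ℂ) * Complex.I * q)) ≠ 0 :=
    neg_ne_zero.2 (mul_ne_zero Complex.two_pi_I_ne_zero (by exact_mod_cast hq.ne'))
  have hiter : ∀ᶠ a : ℝ in 𝓝[>] (0 : ℝ), ∀ n : ℕ,
      (a : ℂ) ^ n * ∫ x in (0 : ℝ)..1,
        ((g a)^[q] (circlePi a x) / circlePi a x - 1) / circlePi a x ^ n =
      (a : ℂ) ^ k * ∫ x in (0 : ℝ)..1, (Complex.exp (2 * Real.pi * Complex.I *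
        (((F (τ (a, 0)) a)^[q] x - x - p : ℝ) : ℂ)) - 1) / (a : ℂ) ^ k *
        Complex.exp (-(2 * Real.pi * Complex.I * n * x)) := by
    filter_upwards [hsemi, self_mem_nhdsWithin] with a ha ha0 n
    have ha0 : a ≠ 0 := ne_of_gt ha0
    have ha0' : (a : ℂ) ≠ 0 := by exact_mod_cast ha0
    rw [← intervalIntegral.integral_const_mul, ← intervalIntegral.integral_const_mul]
    refine intervalIntegral.integral_congr fun x _ => ?_
    have h1 : (g a)^[q] (circlePi a x) = circlePi a ((F (τ (a, 0)) a)^[q] x) :=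
      (Function.Semiconj.iterate_right (f := circlePi a)
        (fun x => (ha x).symm : Function.Semiconj (circlePi a) _ _) q x).symm
    have h2 := circlePi_div_sub_one_div_pow ha0 x ((F (τ (a, 0)) a)^[q] x - x - p) p n
    rw [show x + ((F (τ (a, 0)) a)^[q] x - x - p) + p = (F (τ (a, 0)) a)^[q] x by ring] at h2
    rw [h1, h2]
    field_simp
  constructor
  · intro n hn
    have h1 := h.tendsto_integral_exp_displacement hk0 hk n
    have hs : Tendsto (fun a : ℝ => (a : ℂ) ^ (n - k)) (𝓝[>] 0) (𝓝 0) := by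
      have : Tendsto (fun a : ℝ => (a : ℂ) ^ (n - k)) (𝓝 0) (𝓝 (((0 : ℝ) : ℂ) ^ (n - k))) :=
        Continuous.tendsto (by fun_prop) 0
      rw [Complex.ofReal_zero, zero_pow (by omega)] at this
      exact this.mono_left nhdsWithin_le_nhds
    have h2 := hs.mul (hc n)
    rw [zero_mul] at h2
    have h3 := tendsto_nhds_unique (h1.congr' ?_) h2
    · exact (mul_eq_zero.1 h3).resolve_left hfac
    · filter_upwards [hiter, self_mem_nhdsWithin] with a ha ha0
      have ha0' : (a : ℂ) ≠ 0 := by exact_mod_cast (ne_of_gt (Set.mem_Ioi.1 ha0) : a ≠ 0)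
      have h4 := ha n
      rw [show n = k + (n - k) by omega, pow_add, mul_assoc] at h4
      rw [← show n = k + (n - k) by omega] at h4
      exact (mul_left_cancel₀ (pow_ne_zero k ha0') h4).symm
  · rintro rfl
    have h1 := h.tendsto_integral_exp_displacement hk0 hk k
    have h2 := hc k
    rw [hcq] at h2
    have h3 := tendsto_nhds_unique (h1.congr' ?_) h2
    · rw [← h3, neg_mul, neg_div, neg_neg, mul_div_cancel_left₀ _ (neg_ne_zero.1 hfac)]
    · filter_upwards [hiter, self_mem_nhdsWithin] with a ha ha0
      have ha0' : (a : ℂ) ≠ 0 := by exact_mod_cast (ne_of_gt (Set.mem_Ioi.1 ha0) : a ≠ 0)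
      exact (mul_left_cancel₀ (pow_ne_zero k ha0') (ha k)).symm

/-- A nonzero index is either not divisible by `q` or at least `q > k`, so all nonconstant Fourier
modes vanish. The remaining constant is the value at `x = 0`, which is zero by normalisation. -/
theorem tongueQuotient_eq_zero (h : IsLocalTongue F t₀ p q τ) (hq : 0 < q)
    (hpq : Int.gcd p q = 1) (hg : IsGuide r g φ)
    (hsemi : ∀ᶠ a in 𝓝[>] (0 : ℝ), ∀ x, g a (circlePi a x) = circlePi a (F (τ (a, 0)) a x))
    (hexp : (fun z : ℂ => φ^[q] z - (z + C * z ^ (q + 1))) =O[𝓝 0] (fun z : ℂ => z ^ (q + 2)))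
    {k : ℕ} (hkq : k < q) (x : ℝ) : tongueQuotient τ k (0, x) = 0 := by
  induction k using Nat.strong_induction_on generalizing x with
  | _ k ih =>
    have hk : ∀ j < k, ∀ x, tongueQuotient τ j (0, x) = 0 := fun j hj x => ih j hj (hj.trans hkq) x
    rcases Nat.eq_zero_or_pos k with rfl | hk0
    · simp [tongueQuotient, h.zero_left]
    have hF := (h.fourier_tongueQuotient hq hg hsemi hexp hk0 hk).1
    obtain ⟨c, hc⟩ := eq_add_re_of_fourier_eq_zero (h.continuous_tongueQuotient k)
      (h.tongueQuotient_periodic k 0) hq fun n hn hnq => by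
        by_cases hd : q ∣ n
        · exact hF n (hkq.trans_le (Nat.le_of_dvd hn hd))
        · exact h.fourier_tongueQuotient_eq_zero_of_not_dvd hq hpq hk hd
    simp only [hF q hkq, zero_mul, Complex.zero_re, mul_zero, add_zero] at hc
    rw [hc, ← hc 0, tongueQuotient_zero_right]

theorem exists_tongueQuotient_eq (h : IsLocalTongue F t₀ p q τ) (hq : 0 < q)
    (hpq : Int.gcd p q = 1) (hg : IsGuide r g φ)
    (hsemi : ∀ᶠ a in 𝓝[>] (0 : ℝ), ∀ x, g a (circlePi a x) = circlePi a (F (τ (a, 0)) a x))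
    (hexp : (fun z : ℂ => φ^[q] z - (z + C * z ^ (q + 1))) =O[𝓝 0] (fun z : ℂ => z ^ (q + 2))) :
    ∃ c : ℝ, ∀ x : ℝ, tongueQuotient τ q (0, x) = c + 2 * (-(C / (2 * Real.pi * Complex.I * q)) *
      Complex.exp (2 * Real.pi * Complex.I * q * x)).re := by
  have hk : ∀ j < q, ∀ x, tongueQuotient τ j (0, x) = 0 := fun j hj =>
    h.tongueQuotient_eq_zero hq hpq hg hsemi hexp hj
  obtain ⟨h1, h2⟩ := h.fourier_tongueQuotient hq hg hsemi hexp hq hk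
  obtain ⟨c, hc⟩ := eq_add_re_of_fourier_eq_zero (h.continuous_tongueQuotient q)
    (h.tongueQuotient_periodic q 0) hq fun n hn hnq => by
      by_cases hd : q ∣ n
      · exact h1 n (lt_of_le_of_ne (Nat.le_of_dvd hn hd) hnq.symm)
      · exact h.fourier_tongueQuotient_eq_zero_of_not_dvd hq hpq hk hd
  rw [h2 rfl] at hc
  exact ⟨c, hc⟩

end IsLocalTongue

/-! ### An analytic point of maximum. -/

theorem exists_nat_mul_add_mul_eq {p : ℤ} {q : ℕ} (hq : 0 < q) (hpq : Int.gcd p q = 1) (j : ℤ) :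
    ∃ (k : ℕ) (m : ℤ), k * p + m * q = j := by
  have hb := Int.gcd_eq_gcd_ab p q
  rw [hpq] at hb
  set u := Int.gcdA p q
  set v := Int.gcdB p q
  have hq0 : (q : ℤ) ≠ 0 := by exact_mod_cast hq.ne'
  -- The Bézout coefficient is reduced modulo `q` to be nonnegative, since it will count iterations.
  obtain ⟨k, hk⟩ := Int.eq_ofNat_of_zero_le (Int.emod_nonneg (j * u) hq0)
  have hd := Int.mul_ediv_add_emod (j * u) q
  rw [hk] at hd
  refine ⟨k, j * v + (j * u / q) * p, ?_⟩
  push_cast at hb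
  linear_combination p * hd - j * hb

theorem hasDerivAt_snd_of_differentiableAt {H : ℝ × ℝ → ℝ} {a x : ℝ}
    (hH : DifferentiableAt ℝ H (a, x)) :
    HasDerivAt (fun x => H (a, x)) (fderiv ℝ H (a, x) (0, 1)) x :=
  hH.hasFDerivAt.comp_hasDerivAt x ((hasDerivAt_const x a).prodMk (hasDerivAt_id x))

namespace IsLocalTongue

variable {F : ℝ → ℝ → ℝ → ℝ} {t₀ : ℝ} {p : ℤ} {q : ℕ} {τ : ℝ × ℝ → ℝ}

theorem tongueQuotient_add_int (h : IsLocalTongue F t₀ p q τ) (k : ℕ) (a x : ℝ) (m : ℤ) :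
    tongueQuotient τ k (a, x + m) = tongueQuotient τ k (a, x) := by
  have hp : Function.Periodic (fun x => tongueQuotient τ k (a, x)) 1 :=
    h.tongueQuotient_periodic k a
  simpa using hp.int_mul m x

/-- Since the points of one orbit have the same value of `τ`, the maxima of the `q`-th quotient
can all be moved to a single one, which depends analytically on `a`. -/
theorem exists_analytic_max (h : IsLocalTongue F t₀ p q τ) (hq : 0 < q) (hpq : Int.gcd p q = 1)
    (hk : ∀ j < q, ∀ x, tongueQuotient τ j (0, x) = 0) {s c A x₀ : ℝ} (hA : 0 < A)
    (hH : ∀ x, s * tongueQuotient τ q (0, x) = c + A * Real.cos (2 * Real.pi * q * (x - x₀))) :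
    ∃ ξ : ℝ → ℝ, AnalyticAt ℝ ξ 0 ∧ ξ 0 = x₀ ∧
      ∀ᶠ a in 𝓝 (0 : ℝ), ∀ x, s * tongueQuotient τ q (a, x) ≤ s * tongueQuotient τ q (a, ξ a) := by
  set H := tongueQuotient τ q with hHdef
  have hq0 : (0 : ℝ) < q := by exact_mod_cast hq
  have hHa : ∀ x, AnalyticAt ℝ H (0, x) := h.analyticAt_tongueQuotient q
  set u : ℝ × ℝ → ℝ := fun v => s * fderiv ℝ H v (0, 1) with hu
  have hua : AnalyticAt ℝ u (0, x₀) := by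
    refine analyticAt_const.mul ?_
    exact ((ContinuousLinearMap.apply ℝ ℝ ((0 : ℝ), (1 : ℝ))).analyticAt _).fun_comp (hHa x₀).fderiv
  have hu0 : ∀ x, u (0, x) = -(A * (2 * Real.pi * q) * Real.sin (2 * Real.pi * q * (x - x₀))) := by
    intro x
    have h1 := (hasDerivAt_snd_of_differentiableAt (hHa x).differentiableAt).const_mul s
    simp only [hH] at h1
    have h2 : HasDerivAt (fun x : ℝ => 2 * Real.pi * q * (x - x₀)) (2 * Real.pi * q * 1) x :=
      ((hasDerivAt_id x).sub_const x₀).const_mul _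
    have h3 := (h2.cos.const_mul A).const_add c
    rw [hu]
    dsimp only
    rw [h1.unique h3]
    ring
  have hud : HasDerivAt (fun x => u (0, x)) (-(A * (2 * Real.pi * q) ^ 2)) x₀ := by
    simp only [hu0]
    have h2 : HasDerivAt (fun x : ℝ => 2 * Real.pi * q * (x - x₀)) (2 * Real.pi * q * 1) x₀ :=
      ((hasDerivAt_id x₀).sub_const x₀).const_mul _
    have h3 := (h2.sin.const_mul (A * (2 * Real.pi * q))).neg
    refine h3.congr_deriv ?_
    rw [sub_self, mul_zero, Real.cos_zero]
    ring
  have hd0 : -(A * (2 * Real.pi * q) ^ 2) ≠ 0 := by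
    have := Real.pi_pos
    have : 0 < A * (2 * Real.pi * q) ^ 2 := by positivity
    linarith
  obtain ⟨ξ, hξa, hξ0, hξ⟩ := hua.exists_implicit (by rw [hu0]; simp) hud hd0
  refine ⟨ξ, hξa, hξ0, ?_⟩
  have hloc : ∀ᶠ v in 𝓝 ((0 : ℝ), x₀), (u v = 0 ↔ v.2 = ξ v.1) ∧ DifferentiableAt ℝ H v :=
    hξ.and ((hHa x₀).eventually_analyticAt.mono fun v hv => hv.differentiableAt)
  obtain ⟨η, hη, hηloc⟩ := Metric.eventually_nhds_iff.1 hloc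
  have hmax0 : ∀ x, s * H (0, x) ≤ s * H (0, x₀) := by
    intro x
    rw [hH, hH, sub_self, mul_zero, Real.cos_zero]
    nlinarith [Real.cos_le_one (2 * Real.pi * q * (x - x₀))]
  -- Dichotomy: either the orbit of `y` comes close to `x₀` modulo `1`, or the value at `y` is
  -- strictly below the one at `x₀` and `y` is not a maximum.
  have hcompact : ∀ᶠ a in 𝓝 (0 : ℝ), ∀ y ∈ Set.Icc (0 : ℝ) 1,
      ((∃ (k : ℕ) (m : ℤ), |(F (τ (a, y)) a)^[k] y + m - x₀| < η) ∨ s * H (a, y) < s * H (a, x₀)) ∧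
        ContinuousAt H (a, y) := by
    refine isCompact_Icc.eventually_forall_of_forall_eventually (P := fun a y =>
      ((∃ (k : ℕ) (m : ℤ), |(F (τ (a, y)) a)^[k] y + m - x₀| < η) ∨ s * H (a, y) < s * H (a, x₀)) ∧
        ContinuousAt H (a, y)) fun y _ => ?_
    refine Eventually.and ?_ ((hHa y).eventually_analyticAt.mono fun v hv => hv.continuousAt)
    -- At a maximum of the limit, `y - x₀ = j / q`; by coprimality some iterate of the rotation by
    -- `p / q` sends `y` to `x₀` modulo `1`.
    by_cases hy : Real.cos (2 * Real.pi * q * (y - x₀)) = 1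
    · obtain ⟨j, hj⟩ := (Real.cos_eq_one_iff _).1 hy
      obtain ⟨k, m, hkm⟩ := exists_nat_mul_add_mul_eq hq hpq (-j)
      have hkm' : (k : ℝ) * p + m * q = -j := by exact_mod_cast hkm
      have hj' : (j : ℝ) = q * (y - x₀) := by
        refine mul_right_cancel₀ Real.two_pi_pos.ne' ?_
        rw [hj]; ring
      have hlim : y + k * ((p : ℝ) / q) + m - x₀ = 0 := by
        field_simp
        linarith
      have h2 : Tendsto (fun v : ℝ × ℝ => ((v.1, τ v, v.2) : ℝ × ℝ × ℝ)) (𝓝 (0, y))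
          (𝓝 (0, t₀, y)) := by
        have h3 := (h.analyticAt y).continuousAt.tendsto
        rw [h.zero_left] at h3
        rw [nhds_prod_eq (x := (0 : ℝ)) (y := (t₀, y)), nhds_prod_eq (x := t₀)]
        exact (continuous_fst.tendsto ((0 : ℝ), y)).prodMk
          (h3.prodMk (continuous_snd.tendsto ((0 : ℝ), y)))
      have h4 := (h.continuousAt_iterate k y).tendsto.comp h2
      dsimp only at h4
      rw [h.iterate_zero] at h4
      have h5 := ((h4.add_const (m : ℝ)).sub_const x₀).abs
      rw [hlim, abs_zero] at h5
      filter_upwards [h5.eventually (eventually_lt_nhds hη)] with v hv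
      exact Or.inl ⟨k, m, hv⟩
    · have h1 : s * H (0, y) < s * H (0, x₀) := by
        rw [hH, hH, sub_self, mul_zero, Real.cos_zero]
        have := lt_of_le_of_ne (Real.cos_le_one _) hy
        nlinarith
      have h2 : ContinuousAt (fun v : ℝ × ℝ => s * H v) (0, y) :=
        (hHa y).continuousAt.const_mul s
      have h3 : ContinuousAt (fun v : ℝ × ℝ => s * H (v.1, x₀)) (0, y) :=
        ContinuousAt.const_mul (ContinuousAt.comp (f := fun v : ℝ × ℝ => (v.1, x₀))
          (hHa x₀).continuousAt (by fun_prop)) s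
      filter_upwards [h2.eventually_lt h3 h1] with v hv
      exact Or.inr hv
  have hne : ∀ᶠ a in 𝓝[≠] (0 : ℝ), ∀ x, s * H (a, x) ≤ s * H (a, ξ a) := by
    filter_upwards [hcompact.filter_mono nhdsWithin_le_nhds,
      h.eventually_tongueQuotient_apply_iterate hk,
      (Metric.ball_mem_nhds (0 : ℝ) hη |> mem_nhdsWithin_of_mem_nhds)] with a ha hinv haη
    obtain ⟨y, hy, hymax⟩ := isCompact_Icc.exists_isMaxOn (Set.nonempty_Icc.2 zero_le_one)
      (f := fun y => s * H (a, y)) fun y hy =>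
        (ContinuousAt.const_mul (ContinuousAt.comp (f := fun y : ℝ => (a, y))
          (ha y hy).2 (by fun_prop)) s).continuousWithinAt
    have hglob : ∀ x, s * H (a, x) ≤ s * H (a, y) := by
      intro x
      have hp : Function.Periodic (fun x => H (a, x)) 1 := h.tongueQuotient_periodic q a
      obtain ⟨x', hx', e⟩ := hp.exists_mem_Ico₀ one_pos x
      rw [show H (a, x) = H (a, x') from e]
      exact hymax ⟨hx'.1, hx'.2.le⟩
    obtain ⟨k, m, hkm⟩ := (ha y hy).1.resolve_right (not_lt.2 (hglob x₀))
    set y' := (F (τ (a, y)) a)^[k] y + m with hy'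
    have hval : H (a, y') = H (a, y) := by
      rw [hy', hHdef, h.tongueQuotient_add_int, hinv y k]
    obtain ⟨hiff, hdiff⟩ := hηloc (y := (a, y')) (by
      rw [Prod.dist_eq, max_lt_iff]
      exact ⟨haη, hkm⟩)
    -- The moved point `y'` is still a global maximum, hence critical, and near `x₀` the only
    -- critical point is `ξ a`.
    have hcrit : u (a, y') = 0 := by
      have hmax : IsLocalMax (fun x => s * H (a, x)) y' :=
        Eventually.of_forall fun x => by dsimp only; rw [hval]; exact hglob x
      exact hmax.hasDerivAt_eq_zero ((hasDerivAt_snd_of_differentiableAt hdiff).const_mul s)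
    have e : y' = ξ a := hiff.1 hcrit
    intro x
    rw [← e, hval]
    exact hglob x
  rw [eventually_nhdsWithin_iff] at hne
  filter_upwards [hne] with a ha
  rcases eq_or_ne a 0 with rfl | ha0
  · rw [hξ0]; exact hmax0
  · exact ha ha0

end IsLocalTongue

/-! ### Assembling the theorem. -/

theorem mem_tongue_iff {I J : Set ℝ} {F : ℝ → ℝ → ℝ → ℝ} {t a : ℝ} (ht : t ∈ I) (ha : a ∈ J)
    (hl : IsCircleLift (F t a)) {p : ℤ} {q : ℕ} (hq : 0 < q) :
    (t, a) ∈ tongue I J F ((p : ℝ) / q) ↔ ∃ x, (F t a)^[q] x = x + p := by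
  have key : transNumber (F t a) hl = (p : ℝ) / q ↔ ∃ x, (F t a)^[q] x = x + p := by
    rw [transNumber, CircleDeg1Lift.translationNumber_eq_rat_iff _ hl.continuous hq]
    simp only [CircleDeg1Lift.coe_pow]
    rfl
  rw [← key]
  exact ⟨fun h => h.2.2.2, fun h => ⟨ht, ha, hl, h⟩⟩

/-- Restriction to a curve `t = α a` leaves a family in `a` alone. The semiconjugacy makes `g a`
preserve the circle `|z| = a`. -/
theorem IsGuidedBy.exists_isGuide {I J : Set ℝ} {F : ℝ → ℝ → ℝ → ℝ} {r : ℝ} {f : ℝ → ℂ → ℂ}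
    (hf : IsGuidedBy I J F r f) (hr : 0 < r) (hI : IsOpen I) (hJ : IsOpen J) (hJ0 : (0 : ℝ) ∈ J)
    {α : ℝ → ℝ} (hα : ContinuousAt α 0) (hα0 : α 0 ∈ I) :
    ∃ g, IsGuide r g (f (α 0)) ∧
      ∀ᶠ a in 𝓝[>] (0 : ℝ), ∀ x, g a (circlePi a x) = circlePi a (F (α a) a x) := by
  obtain ⟨hd, g, hga, hgd, hg0, hgs, hgf⟩ := hf
  have hmem : ∀ᶠ a in 𝓝 (0 : ℝ), α a ∈ I ∧ a ∈ J ∩ Set.Ioo (-r) r :=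
    (hα.eventually_mem (hI.mem_nhds hα0)).and
      ((hJ.inter isOpen_Ioo).mem_nhds ⟨hJ0, by simpa using hr, hr⟩)
  have h0 := hmem.self_of_nhds.2
  have hsemi : ∀ᶠ a in 𝓝[>] (0 : ℝ), ∀ x,
      g (α a) a (circlePi a x) = circlePi a (F (α a) a x) := by
    filter_upwards [hmem.filter_mono nhdsWithin_le_nhds, self_mem_nhdsWithin] with a ha ha0
    exact hgs _ ha.1 _ ha.2 (ne_of_gt ha0)
  refine ⟨fun a => g (α a) a, ⟨hr, hd _ hα0, fun z hz hzr => ?_, fun z hz hzr => ?_, ?_, ?_, ?_⟩,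
    hsemi⟩
  · have h1 := (hga (α 0, 0, z) ⟨hα0, h0, by simpa using hz, hzr⟩).continuousAt
    have h2 : ContinuousAt (fun w : ℝ × ℂ => ((α w.1, w.1, w.2) : ℝ × ℝ × ℂ)) (0, z) :=
      (ContinuousAt.comp (f := Prod.fst) hα continuousAt_fst).prodMk
        (continuousAt_fst.prodMk continuousAt_snd)
    exact ContinuousAt.comp (f := fun w : ℝ × ℂ => ((α w.1, w.1, w.2) : ℝ × ℝ × ℂ)) h1 h2
  · exact hgf _ hα0 z (by simpa using hzr) hz
  · filter_upwards [hmem] with a ha using hgd _ ha.1 _ ha.2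
  · filter_upwards [hmem] with a ha using hg0 _ ha.1 _ ha.2
  · filter_upwards [hsemi, self_mem_nhdsWithin] with a ha ha0 z hz
    obtain ⟨x, rfl⟩ := exists_circlePi_eq hz
    rw [ha, norm_circlePi ha0]

theorem two_mul_re_mul_exp_eq {κ : ℂ} {q : ℕ} (hq : 0 < q) (x : ℝ) :
    2 * (κ * Complex.exp (2 * Real.pi * Complex.I * q * x)).re =
      2 * ‖κ‖ * Real.cos (2 * Real.pi * q * (x - -(κ.arg / (2 * Real.pi * q)))) := by
  have hq0 : (q : ℝ) ≠ 0 := by exact_mod_cast hq.ne'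
  have h1 : 2 * Real.pi * q * (x - -(κ.arg / (2 * Real.pi * q))) = 2 * Real.pi * q * x + κ.arg := by
    have := Real.pi_ne_zero
    field_simp
    ring
  have h2 : κ * Complex.exp (2 * Real.pi * Complex.I * q * x) =
      (‖κ‖ : ℂ) * Complex.exp (((2 * Real.pi * q * x + κ.arg : ℝ) : ℂ) * Complex.I) := by
    conv_lhs => rw [← Complex.norm_mul_exp_arg_mul_I κ]
    rw [mul_assoc, ← Complex.exp_add]
    congr 2
    push_cast
    ring
  rw [h1, h2, Complex.re_ofReal_mul, Complex.exp_ofReal_mul_I_re]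
  ring

theorem mainTheorem1 (I J : Set ℝ) (hI : IsOpen I) (hI' : I.OrdConnected)
    (hJ : IsOpen J) (hJ' : J.OrdConnected) (hJ0 : (0 : ℝ) ∈ J)
    (F : ℝ → ℝ → ℝ → ℝ) (θ : ℝ → ℝ) (hF : IsAdmissible I J F θ)
    (r : ℝ) (hr : 0 < r) (f : ℝ → ℂ → ℂ) (hf : IsGuidedBy I J F r f)
    (t₀ : ℝ) (ht₀ : t₀ ∈ I) (p : ℤ) (q : ℕ) (hq : 0 < q) (hpq : Int.gcd p (q : ℤ) = 1)
    (hθ : θ t₀ = (p : ℝ) / (q : ℝ)) (hθ' : HasDerivAt θ 1 t₀)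
    (C : ℂ) (hC : C ≠ 0)
    (hexp : (fun z : ℂ => (f t₀)^[q] z - (z + C * z ^ (q + 1))) =O[𝓝 0]
      (fun z : ℂ => z ^ (q + 2))) :
    ∃ (I' J' : Set ℝ) (γm γp : ℝ → ℝ),
      IsOpen I' ∧ I'.OrdConnected ∧ t₀ ∈ I' ∧ I' ⊆ I ∧
      IsOpen J' ∧ J'.OrdConnected ∧ (0 : ℝ) ∈ J' ∧ J' ⊆ J ∧
      AnalyticOnNhd ℝ γm J' ∧ Set.MapsTo γm J' I' ∧
      AnalyticOnNhd ℝ γp J' ∧ Set.MapsTo γp J' I' ∧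
      (∀ t ∈ I', ∀ a ∈ J', IsCircleLift (F t a)) ∧
      (∀ t ∈ I', ∀ a ∈ J', (t, a) ∈ tongue I J F ((p : ℝ) / (q : ℝ)) ↔
        t ∈ Set.uIcc (γm a) (γp a)) ∧
      (fun a : ℝ => γp a - γm a) ~[𝓝 0]
        (fun a : ℝ => 2 * ‖C‖ / (Real.pi * (q : ℝ)) * a ^ q) := by
  have hq0 : (q : ℝ) ≠ 0 := by exact_mod_cast hq.ne'
  obtain ⟨τ, h⟩ := hF.exists_isLocalTongue hI hJ hJ0 ht₀ hq hθ hθ'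
  have hα : ContinuousAt (fun a => τ (a, 0)) 0 :=
    ContinuousAt.comp (f := fun a : ℝ => (a, (0 : ℝ))) (h.analyticAt 0).continuousAt (by fun_prop)
  obtain ⟨g, hg, hsemi⟩ := hf.exists_isGuide hr hI hJ hJ0 hα (by rwa [h.zero_left])
  rw [h.zero_left] at hg
  have hk : ∀ j < q, ∀ x, tongueQuotient τ j (0, x) = 0 := fun j hj =>
    h.tongueQuotient_eq_zero hq hpq hg hsemi hexp hj
  obtain ⟨c, hc⟩ := h.exists_tongueQuotient_eq hq hpq hg hsemi hexp
  set κ : ℂ := -(C / (2 * Real.pi * Complex.I * q)) with hκ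
  have hκ0 : ‖κ‖ = ‖C‖ / (2 * Real.pi * q) := by
    rw [hκ, norm_neg, norm_div]
    simp [abs_of_pos Real.pi_pos]
  have hA : 0 < 2 * ‖κ‖ := by
    have h1 : 0 < ‖C‖ := norm_pos_iff.2 hC
    have h2 := Real.pi_pos
    rw [hκ0]
    positivity
  set x₀ : ℝ := -(κ.arg / (2 * Real.pi * q)) with hx₀
  simp only [two_mul_re_mul_exp_eq hq, ← hx₀] at hc
  obtain ⟨ξp, hpa, hp0, hpmax⟩ := h.exists_analytic_max hq hpq hk (s := 1) (c := c) (x₀ := x₀) hA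
    (fun x => by rw [one_mul, hc])
  -- The minimum is the maximum of the opposite function, shifted by half the period `1 / q` of the
  -- cosine.
  obtain ⟨ξm, hma, hm0, hmmax⟩ := h.exists_analytic_max hq hpq hk (s := -1) (c := -c)
    (x₀ := x₀ + 1 / (2 * q)) hA (fun x => by
      rw [hc, show 2 * Real.pi * q * (x - (x₀ + 1 / (2 * q))) =
        2 * Real.pi * q * (x - x₀) - Real.pi by field_simp; ring, Real.cos_sub_pi]
      ring)
  have hcomp : ∀ ξ : ℝ → ℝ, AnalyticAt ℝ ξ 0 → AnalyticAt ℝ (fun a => τ (a, ξ a)) 0 :=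
    fun ξ hξ => AnalyticAt.fun_comp (f := fun a => (a, ξ a)) (h.analyticAt _)
      (AnalyticAt.prod analyticAt_id hξ)
  have hγp := hcomp ξp hpa
  have hγm := hcomp ξm hma
  set R : ℝ := |ξp 0| + |ξm 0| + 1 with hR
  have hRlim : ∀ ξ : ℝ → ℝ, AnalyticAt ℝ ξ 0 → |ξ 0| < R → ∀ᶠ a in 𝓝 (0 : ℝ), |ξ a| < R :=
    fun ξ hξ hlt => hξ.continuousAt.abs.eventually_lt continuousAt_const hlt
  have hRp := hRlim ξp hpa (by rw [hR]; linarith [abs_nonneg (ξm 0)])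
  have hRm := hRlim ξm hma (by rw [hR]; linarith [abs_nonneg (ξp 0)])
  have hcont : ∀ᶠ a in 𝓝 (0 : ℝ), ∀ x ∈ Set.Icc (-R) R, ContinuousAt τ (a, x) :=
    isCompact_Icc.eventually_forall_of_forall_eventually (P := fun a x => ContinuousAt τ (a, x))
      fun x _ => (h.analyticAt x).eventually_analyticAt.mono fun v hv => hv.continuousAt
  have hrange : ∀ᶠ a in 𝓝 (0 : ℝ), ∀ t,
      (∃ x, t = τ (a, x)) ↔ t ∈ Set.uIcc (τ (a, ξm a)) (τ (a, ξp a)) := by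
    filter_upwards [hpmax, hmmax, hRp, hRm, hcont] with a h1 h2 h3 h4 h5 t
    constructor
    · rintro ⟨x, rfl⟩
      have e := fun x => sub_eq_pow_mul_tongueQuotient hk (a, x)
      dsimp only at e
      have k1 := h1 x
      have k2 := h2 x
      -- If `a ^ q` is negative, the maximum of the quotient gives the minimum of `τ (a, ·)`, and
      -- the endpoints are exchanged.
      rcases le_total 0 (a ^ q) with hs | hs
      · refine Set.mem_uIcc.2 (Or.inl ⟨?_, ?_⟩)
        · nlinarith [e x, e (ξm a)]
        · nlinarith [e x, e (ξp a)]
      · refine Set.mem_uIcc.2 (Or.inr ⟨?_, ?_⟩)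
        · nlinarith [e x, e (ξp a)]
        · nlinarith [e x, e (ξm a)]
    · intro ht
      -- Between the two extremal points `τ (a, ·)` is continuous, so it takes all intermediate
      -- values; `R` bounds both points for small `a`.
      have hsub : Set.uIcc (ξm a) (ξp a) ⊆ Set.Icc (-R) R :=
        Set.ordConnected_Icc.uIcc_subset (abs_le.1 h4.le) (abs_le.1 h3.le)
      obtain ⟨x, -, hx⟩ := intermediate_value_uIcc (f := fun x => τ (a, x)) (fun x hx =>
        (ContinuousAt.comp (f := fun x : ℝ => (a, x)) (h5 x (hsub hx))
          (by fun_prop)).continuousWithinAt) ht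
      exact ⟨x, hx.symm⟩
  obtain ⟨ε, hε, hεy⟩ := Metric.eventually_nhds_iff.1
    ((IsAdmissible.eventually_mem hI hJ hJ0 ht₀).and (h.isCircleLift.and h.iterate_eq_iff))
  have hball : ∀ ξ : ℝ → ℝ, AnalyticAt ℝ (fun a => τ (a, ξ a)) 0 →
      ∀ᶠ a in 𝓝 (0 : ℝ), τ (a, ξ a) ∈ Metric.ball t₀ ε := fun ξ hξ =>
    hξ.continuousAt.eventually_mem (by rw [h.zero_left]; exact Metric.ball_mem_nhds t₀ hε)
  obtain ⟨δ, hδ, hδa⟩ := Metric.eventually_nhds_iff.1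
    (hrange.and ((hball ξp hγp).and ((hball ξm hγm).and
      (hγp.eventually_analyticAt.and hγm.eventually_analyticAt))))
  have hy : ∀ t ∈ Metric.ball t₀ ε, ∀ a ∈ Metric.ball (0 : ℝ) (min δ ε), dist (a, t) (0, t₀) < ε :=
    fun t ht a ha => by
      rw [Prod.dist_eq]
      exact max_lt (lt_of_lt_of_le ha (min_le_right _ _)) ht
  have hda : ∀ a ∈ Metric.ball (0 : ℝ) (min δ ε), dist a 0 < δ := fun a ha =>
    lt_of_lt_of_le ha (min_le_left _ _)
  have ht₀ε : t₀ ∈ Metric.ball t₀ ε := Metric.mem_ball_self hε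
  have h0δ : (0 : ℝ) ∈ Metric.ball (0 : ℝ) (min δ ε) := Metric.mem_ball_self (lt_min hδ hε)
  refine ⟨Metric.ball t₀ ε, Metric.ball 0 (min δ ε), fun a => τ (a, ξm a), fun a => τ (a, ξp a),
    Metric.isOpen_ball, ?_, ht₀ε, fun t ht => (hεy (hy t ht 0 h0δ)).1.2, Metric.isOpen_ball, ?_,
    h0δ, fun a ha => (hεy (hy t₀ ht₀ε a ha)).1.1, fun a ha => (hδa (hda a ha)).2.2.2.2,
    fun a ha => (hδa (hda a ha)).2.2.1, fun a ha => (hδa (hda a ha)).2.2.2.1,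
    fun a ha => (hδa (hda a ha)).2.1, fun t ht a ha => (hεy (hy t ht a ha)).2.1, ?_, ?_⟩
  · rw [Real.ball_eq_Ioo]; exact Set.ordConnected_Ioo
  · rw [Real.ball_eq_Ioo]; exact Set.ordConnected_Ioo
  · intro t ht a ha
    obtain ⟨⟨haJ, htI⟩, hl, hiff⟩ := hεy (hy t ht a ha)
    rw [mem_tongue_iff htI haJ hl hq, ← (hδa (hda a ha)).1 t]
    exact exists_congr hiff
  · have hlim : Tendsto (fun a => tongueQuotient τ q (a, ξp a) - tongueQuotient τ q (a, ξm a))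
        (𝓝 0) (𝓝 (2 * ‖C‖ / (Real.pi * q))) := by
      have hH : ∀ ξ : ℝ → ℝ, AnalyticAt ℝ ξ 0 → Tendsto (fun a => tongueQuotient τ q (a, ξ a))
          (𝓝 0) (𝓝 (tongueQuotient τ q (0, ξ 0))) := fun ξ hξ =>
        (ContinuousAt.comp (f := fun a => (a, ξ a))
          (h.analyticAt_tongueQuotient q (ξ 0)).continuousAt
          (continuousAt_id.prodMk hξ.continuousAt)).tendsto
      -- The limit is the oscillation `(c + A) - (c - A)` with `A = 2 * ‖κ‖ = ‖C‖ / (π * q)`.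
      have h1 := (hH ξp hpa).sub (hH ξm hma)
      rw [hp0, hm0, hc, hc, sub_self, mul_zero, Real.cos_zero, hκ0,
        show 2 * Real.pi * q * (x₀ + 1 / (2 * q) - x₀) = Real.pi by field_simp; ring,
        Real.cos_pi] at h1
      convert h1 using 2
      have := Real.pi_ne_zero
      field_simp
      ring
    have hne : 2 * ‖C‖ / (Real.pi * q) ≠ 0 := by
      have := norm_ne_zero_iff.2 hC
      have := Real.pi_ne_zero
      positivity
    have h2 := ((isEquivalent_const_iff_tendsto hne).2 hlim).mul
      (IsEquivalent.refl (u := fun a : ℝ => a ^ q) (l := 𝓝 0))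
    refine h2.congr_left (Eventually.of_forall fun a => ?_)
    have e := fun x => sub_eq_pow_mul_tongueQuotient hk (a, x)
    dsimp only [Pi.mul_apply] at e ⊢
    linarith [e (ξp a), e (ξm a)]
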